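/- **Setting.** Let $\mathcal G$ be a finite undirected graph on $N$ nodes in which every node has a neighbour; write $\mathcal N_i$ for the neighbours of $i$ and $\tilde{\mathcal N}_i=\mathcal N_i\cup\{i\}$. Node $i$ chooses allocations $x_i\in\mathbb R^{\tilde{\mathcal N}_i}$ (with $x_i(j)=0$ for $j\notin\tilde{\mathcal N}_i$) and has a closed convex action set $\mathcal X_i\subseteq\mathbb R_+^{\tilde{\mathcal N}_i}$ which lies in a ball of radius $R_i$ and contains a ball of radius $r_i>0$. In round $t$ node $i$ has demand $l_{i,t}\ge 1/L$ (with $L>0$ fixed) and random generation $d_{i,t}\ge 0$. For a joint allocation $x=(x_k)_k$ put $$f_{i,t}(x)=1-\frac1{|\tilde{\mathcal N}_i|}\sum_{j\in\tilde{\mathcal N}_i}\min\Big\{\frac{\sum_{k\in\tilde{\mathcal N}_j}x_k(j)}{l_{j,t}},1\Big\},\qquad g_{i,t}(x_i)=\sum_{j\in\tilde{\mathcal N}_i}x_i(j)-d_{i,t},$$ and assume $|f_{i,t}|\le F_i$ on $\prod_k\mathcal X_k$ and $|g_{i,t}|\le G_i$ on $\mathcal X_i$, with $F_i,G_i>0$.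 **Parameters** (path length $P_T=0$). $\tilde L_i=3L+LR_i/r_i$, $\delta_{i,t}=\big(\tfrac{|\mathcal N_i|F_i}{\tilde L_i}\big)^{1/2}\big(\tfrac{R_i^2/2}{t}\big)^{1/4}$, $\xi_{i,t}=\delta_{i,t}/r_i$, $\beta_{i,t}=\tfrac1{G_it^{1/2}}$, $\gamma_{i,t}=\tfrac1{G_i^2t^{1/2}}$, $K=\lceil\tfrac12\log_2(1+T)\rceil+1$ experts with step sizes $\eta^k_{i,t}=2^{k-1}\sqrt{\tfrac{2R_i^3}{2|\mathcal N_i|F_i\tilde L_i}}\;t^{-3/4}$, $k=1,\dots,K$, and a learning rate $\epsilon>0$. **Algorithm (MA-NSDRS).** Initially $z^k_{i,1}=z_i\in(1-\xi_{i,1})\mathcal X_i$ for all $k$, $\omega^k_{i,1}=\tfrac{K+1}{K}\tfrac1{k(k+1)}$, $q_{i,1}=0$. In round $t=1,\dots,T$ every node $i$ forms $z_{i,t}=\sum_k\omega^k_{i,t}z^k_{i,t}$ and $x_{i,t}=z_{i,t}+\delta_{i,t}u_{i,t}$ with $u_{i,t}$ uniform on the unit sphere of $\mathbb R^{\tilde{\mathcal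 N}_i}$, and plays $x'_{i,t}=\frac{d_{i,t}}{\sum_jx_{i,t}(j)}x_{i,t}$ if $\sum_jx_{i,t}(j)>d_{i,t}$, and $x'_{i,t}=x_{i,t}$ otherwise. Write $f_{i,t}(y)$ for the loss of $i$ when $i$ uses $y$ and every other node $k$ uses $x'_{k,t}$. With $$\hat\nabla f_{i,t}=\tfrac{N}{\delta_{i,t}}f_{i,t}(x_{i,t})u_{i,t},\qquad \hat\nabla g_{i,t}=\tfrac N{\delta_{i,t}}g_{i,t}(x_{i,t})u_{i,t},$$ the updates are $$q_{i,t+1}=\big(q_{i,t}+\gamma_{i,t+1}(g_{i,t}(x'_{i,t})-\beta_{i,t+1}q_{i,t})\big)_+,$$ $$z^k_{i,t+1}=\mathcal P_{(1-\xi_{i,t+1})\mathcal X_i}\big(z^k_{i,t}-\eta^k_{i,t+1}(\hat\nabla f_{i,t}+q_{i,t+1}\hat\nabla g_{i,t})\big),$$ $$\omega^k_{i,t+1}\propto\omega^k_{i,t}\exp(-\epsilon\langle\hat\nabla f_{i,t},z^k_{i,t}-z_{i,t}\rangle),\qquad \sum_k\omega^k_{i,t+1}=1,$$ where $\mathcal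 P$ denotes Euclidean projection. All $u_{i,t}$ are independent of each other, and jointly independent of the generations $d$ and the (possibly random) initial points. **Claim.** For a proper choice of the learning rate $\epsilon=\epsilon_T>0$, the static regret is $\tilde{\mathcal O}(T^{3/4})$: there are $\epsilon_T>0$ and constants $C,p$, depending only on the graph, the sets $\mathcal X_i$ and $R_i,r_i,F_i,G_i,L$, such that for all demands, all distributions of the generations and of the initial points as above, all $T\ge1$ and all nodes $i$, $$\mathbb E\Big[\sum_{t=1}^Tf_{i,t}(x_{i,t})\Big]-\mathbb E\Big[\min_{x\in\mathcal X_i}\sum_{t=1}^Tf_{i,t}(x)\Big]\le C\,T^{3/4}(1+\log T)^p ,$$ both random variables being integrable. -/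

import Mathlib

open MeasureTheory ProbabilityTheory
open scoped Pointwise

namespace EnergySharing

section Network

variable {V : Type*} [Fintype V] [DecidableEq V] (G : SimpleGraph V) [DecidableRel G.Adj]

/-- The neighbourhood of node `i` including `i` itself. -/
def closedNbhd (i : V) : Finset V := insert i (G.neighborFinset i)

/-- Allocation vectors of node `i`: one real coordinate for each node of the closed
neighbourhood of `i`, with the Euclidean norm. -/
abbrev Action (i : V) : Type _ := EuclideanSpace ℝ (closedNbhd G i)

variable {G}

/-- The amount sent to node `j` by a node that uses the allocation `y`
(zero when `j` is not in its closed neighbourhood). -/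
def amount {k : V} (y : Action G k) (j : V) : ℝ :=
  if h : j ∈ closedNbhd G k then y ⟨j, h⟩ else 0

/-- Satisfaction level of node `j` under demands `l` and joint allocation `x`. -/
noncomputable def satisfaction (l : V → ℝ) (x : ∀ k, Action G k) (j : V) : ℝ :=
  min ((∑ k ∈ closedNbhd G j, amount (x k) j) / l j) 1

/-- Loss of node `i` under demands `l` and joint allocation `x`. -/
noncomputable def loss (l : V → ℝ) (x : ∀ k, Action G k) (i : V) : ℝ :=
  1 - (1 / ((closedNbhd G i).card : ℝ)) * ∑ j ∈ closedNbhd G i, satisfaction l x j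

/-- Constraint function of node `i` with generation `d`: distributed energy minus generation. -/
noncomputable def constr {i : V} (d : ℝ) (y : Action G i) : ℝ :=
  ∑ j ∈ closedNbhd G i, amount y j - d

/-- Adjustment step: if more than the generation `d` is distributed, rescale the allocation so
that exactly `d` is distributed. -/
noncomputable def adjust {i : V} (d : ℝ) (y : Action G i) : Action G i :=
  if d < ∑ j ∈ closedNbhd G i, amount y j then
    (d / ∑ j ∈ closedNbhd G i, amount y j) • y
  else y

variable (G)

/-- The static data: action sets `X i`, outer and inner radii `R i`, `r i`, bounds `F i` on the
loss and `B i` on the constraint function, and the Lipschitz constant `L` of the losses. -/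
structure Params where
  X : ∀ i, Set (Action G i)
  R : V → ℝ
  r : V → ℝ
  F : V → ℝ
  B : V → ℝ
  L : ℝ

variable {G}

/-- The standing assumptions on the static data. -/
structure Params.Valid (P : Params G) : Prop where
  degree_pos : ∀ i, 0 < G.degree i
  convex : ∀ i, Convex ℝ (P.X i)
  closed : ∀ i, IsClosed (P.X i)
  nonneg : ∀ i, ∀ y ∈ P.X i, ∀ j, 0 ≤ y j
  outer : ∀ i, ∃ c, P.X i ⊆ Metric.closedBall c (P.R i)
  inner : ∀ i, ∃ c, Metric.closedBall c (P.r i) ⊆ P.X i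
  r_pos : ∀ i, 0 < P.r i
  F_pos : ∀ i, 0 < P.F i
  B_pos : ∀ i, 0 < P.B i
  L_pos : 0 < P.L

namespace Params

variable (P : Params G)

/-- `L̃ = 3 L + L R / r`. -/
noncomputable def Ltilde (i : V) : ℝ := 3 * P.L + P.L * P.R i / P.r i

/-- Exploration radius, for path length zero. -/
noncomputable def delta (i : V) (t : ℕ) : ℝ :=
  ((G.degree i : ℝ) * P.F i / P.Ltilde i) ^ (1 / 2 : ℝ) * (P.R i ^ 2 / 2 / (t : ℝ)) ^ (1 / 4 : ℝ)

/-- Shrinkage parameter. -/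
noncomputable def xi (i : V) (t : ℕ) : ℝ := P.delta i t / P.r i

noncomputable def beta (i : V) (t : ℕ) : ℝ := 1 / (P.B i * (t : ℝ) ^ (1 / 2 : ℝ))

noncomputable def gamma (i : V) (t : ℕ) : ℝ := 1 / (P.B i ^ 2 * (t : ℝ) ^ (1 / 2 : ℝ))

/-- Candidate step sizes; the expert with number `k + 1` uses the factor `2 ^ k`. -/
noncomputable def eta (i : V) (k t : ℕ) : ℝ :=
  2 ^ k * Real.sqrt (2 * P.R i ^ 3 / (2 * (G.degree i : ℝ) * P.F i * P.Ltilde i))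
    * (t : ℝ) ^ (-(3 / 4) : ℝ)

end Params

/-- The number of experts for horizon `T`. -/
noncomputable def numExperts (T : ℕ) : ℕ := ⌈Real.logb 2 (1 + (T : ℝ)) / 2⌉₊ + 1

/-- Euclidean projection onto `C`: a point of `C` nearest to `x` (unique when `C` is a nonempty
closed convex set). -/
noncomputable def proj {E : Type*} [MetricSpace E] [Nonempty E] (C : Set E) (x : E) : E :=
  Classical.epsilon fun p => p ∈ C ∧ ∀ y ∈ C, dist x p ≤ dist x y

variable (G) in
/-- The state of all nodes at the beginning of a round: the expert points, the expert weights,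
and the dual variable. -/
structure State (K : ℕ) where
  point : ∀ i, Fin K → Action G i
  weight : V → Fin K → ℝ
  dual : V → ℝ

/-- State at the beginning of round `1`. -/
noncomputable def State.init (K : ℕ) (z₀ : ∀ i, Action G i) : State G K where
  point i _ := z₀ i
  weight _ k := ((K : ℝ) + 1) / K * (1 / (((k : ℝ) + 1) * ((k : ℝ) + 2)))
  dual _ := 0

namespace State

variable {K : ℕ} (s : State G K) (P : Params G) (ε : ℝ) (t : ℕ)
  (l d : V → ℝ) (u : ∀ i, Action G i)

/-- The weighted combination `z` of the expert points. -/
noncomputable def center (i : V) : Action G i := ∑ k, s.weight i k • s.point i k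

/-- The perturbed point `x = z + δ u` of round `t`. -/
noncomputable def query (i : V) : Action G i := s.center i + P.delta i t • u i

/-- The action `x'` that is played in round `t`. -/
noncomputable def played (i : V) : Action G i := adjust (d i) (s.query P t u i)

/-- The loss function of node `i` in round `t`, as a function of its own allocation, the other
nodes transferring what they play. -/
noncomputable def ownLoss (i : V) (y : Action G i) : ℝ :=
  loss l (Function.update (s.played P t d u) i y) i

/-- One-point estimate of the gradient of the loss function. -/
noncomputable def gradLoss (i : V) : Action G i :=
  ((Fintype.card V : ℝ) / P.delta i t * s.ownLoss P t l d u i (s.query P t u i)) • u i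

/-- One-point estimate of the gradient of the constraint function. -/
noncomputable def gradConstr (i : V) : Action G i :=
  ((Fintype.card V : ℝ) / P.delta i t * constr (d i) (s.query P t u i)) • u i

/-- Dual variable of round `t + 1`. -/
noncomputable def nextDual (i : V) : ℝ :=
  max (s.dual i + P.gamma i (t + 1) *
    (constr (d i) (s.played P t d u i) - P.beta i (t + 1) * s.dual i)) 0

/-- Surrogate loss of round `t`. -/
noncomputable def surrogate (i : V) (y : Action G i) : ℝ :=
  inner ℝ (s.gradLoss P t l d u i) (y - s.center i)

/-- Passage from round `t` to round `t + 1`. -/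
noncomputable def next : State G K where
  point i k := proj ((1 - P.xi i (t + 1)) • P.X i)
    (s.point i k - P.eta i k (t + 1) •
      (s.gradLoss P t l d u i + s.nextDual P t d u i • s.gradConstr P t d u i))
  weight i k :=
    s.weight i k * Real.exp (-ε * s.surrogate P t l d u i (s.point i k)) /
      ∑ k', s.weight i k' * Real.exp (-ε * s.surrogate P t l d u i (s.point i k'))
  dual i := s.nextDual P t d u i

end State

/-- `run … n` is the state at the beginning of round `n + 1`. -/
noncomputable def run (P : Params G) (K : ℕ) (ε : ℝ) (l d : ℕ → V → ℝ)
    (u : ℕ → ∀ i, Action G i) (z₀ : ∀ i, Action G i) : ℕ → State G K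
  | 0 => State.init K z₀
  | n + 1 => (run P K ε l d u z₀ n).next P ε (n + 1) (l (n + 1)) (d (n + 1)) (u (n + 1))

/-- Cumulative loss of node `i` over rounds `1, …, T`. -/
noncomputable def cumLoss (P : Params G) (ε : ℝ) (l d : ℕ → V → ℝ)
    (u : ℕ → ∀ i, Action G i) (z₀ : ∀ i, Action G i) (T : ℕ) (i : V) : ℝ :=
  ∑ n ∈ Finset.range T,
    let s := run P (numExperts T) ε l d u z₀ n
    s.ownLoss P (n + 1) (l (n + 1)) (d (n + 1)) (u (n + 1)) i (s.query P (n + 1) (u (n + 1)) i)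

/-- Cumulative loss over rounds `1, …, T` of the best fixed action of node `i` in hindsight. -/
noncomputable def bestLoss (P : Params G) (ε : ℝ) (l d : ℕ → V → ℝ)
    (u : ℕ → ∀ i, Action G i) (z₀ : ∀ i, Action G i) (T : ℕ) (i : V) : ℝ :=
  ⨅ y : P.X i, ∑ n ∈ Finset.range T,
    (run P (numExperts T) ε l d u z₀ n).ownLoss P (n + 1) (l (n + 1)) (d (n + 1)) (u (n + 1))
      i (y : Action G i)

end Network

/-- The uniform distribution on the unit sphere. -/
noncomputable def uniformSphere (E : Type*) [NormedAddCommGroup E] [InnerProductSpace ℝ E]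
    [FiniteDimensional ℝ E] [MeasurableSpace E] [BorelSpace E] :
    Measure (Metric.sphere (0 : E) 1) :=
  ((volume : Measure E).toSphere Set.univ)⁻¹ • (volume : Measure E).toSphere

section Environment

variable {V : Type*} [Fintype V] [DecidableEq V] {G : SimpleGraph V} [DecidableRel G.Adj]

variable (G) in
/-- The environment and the random inputs of the algorithm on a probability space: demands `l`,
random generations `d`, exploration directions `u`, and initial points `z₀`. -/
structure Environment (Ω : Type*) where
  l : ℕ → V → ℝ
  d : ℕ → V → Ω → ℝ
  u : ℕ → ∀ i, Ω → Metric.sphere (0 : Action G i) 1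
  z₀ : ∀ i, Ω → Action G i

/-- The assumptions on the environment and on the random inputs. -/
structure Environment.Valid {Ω : Type*} [MeasurableSpace Ω] (ℰ : Environment G Ω) (P : Params G)
    (μ : Measure Ω) : Prop where
  measurable_d : ∀ t i, Measurable (ℰ.d t i)
  measurable_u : ∀ t i, Measurable (ℰ.u t i)
  measurable_z₀ : ∀ i, Measurable (ℰ.z₀ i)
  demand : ∀ t i, 1 / P.L ≤ ℰ.l t i
  generation : ∀ t i, ∀ᵐ ω ∂μ, 0 ≤ ℰ.d t i ω
  loss_bound : ∀ t i, ∀ x : ∀ k, Action G k, (∀ k, x k ∈ P.X k) → |loss (ℰ.l t) x i| ≤ P.F i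
  constr_bound : ∀ t i, ∀ᵐ ω ∂μ, ∀ y ∈ P.X i, |constr (ℰ.d t i ω) y| ≤ P.B i
  start : ∀ i, ∀ᵐ ω ∂μ, ℰ.z₀ i ω ∈ (1 - P.xi i 1) • P.X i
  uniform_u : ∀ t i, μ.map (ℰ.u t i) = uniformSphere (Action G i)
  indep_u : iIndepFun (fun (p : ℕ × V) ω => ℰ.u p.1 p.2 ω) μ
  indep_env : IndepFun (fun ω => ((fun t i => ℰ.d t i ω), (fun i => ℰ.z₀ i ω)))
    (fun ω t i => ℰ.u t i ω) μ

namespace Environment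

variable {Ω : Type*} (ℰ : Environment G Ω) (P : Params G) (ε : ℝ) (T : ℕ) (i : V)

/-- Cumulative loss of node `i` as a random variable. -/
noncomputable def algLoss (ω : Ω) : ℝ :=
  cumLoss P ε ℰ.l (fun t k => ℰ.d t k ω) (fun t k => (ℰ.u t k ω : Action G k))
    (fun k => ℰ.z₀ k ω) T i

/-- Best cumulative loss in hindsight of node `i` as a random variable. -/
noncomputable def minLoss (ω : Ω) : ℝ :=
  bestLoss P ε ℰ.l (fun t k => ℰ.d t k ω) (fun t k => (ℰ.u t k ω : Action G k))
    (fun k => ℰ.z₀ k ω) T i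

/-- Static regret of node `i`. -/
noncomputable def staticRegret [MeasurableSpace Ω] (μ : Measure Ω) : ℝ :=
  ∫ ω, ℰ.algLoss P ε T i ω ∂μ - ∫ ω, ℰ.minLoss P ε T i ω ∂μ

end Environment

end Environment

end EnergySharing

/-! The dual variable plays no role: the adjustment step makes every played action satisfy the
constraint, so started at 0 it stays 0 (`run_dual`), and each expert performs projected descent on
one-point estimates of the loss alone.

As a function of its own allocation, the loss of a node is a constant plus a sum of convex Lipschitz
functions of single coordinates (`State.ownLoss_eq`). Averaging the estimate over a direction and
its reflection in one coordinate leaves a symmetric difference of a single summand, which is an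
approximate subgradient (`symm_diff_mul_le`, `inner_integral_smul_le`). Since the estimate is scaled
by the number N of nodes and not by the dimension n of the action space, its conditional mean is N/n
times an approximate subgradient up to O(δ), and the regret picks up the harmless factor n/N.

Pathwise, the regret splits into four parts: the weighted combination against the first expert
(exponential weights), the first expert against the shrunken comparator (1-ξ)x (projected descent),
the bias from δ and ξ, and the noise, that is, conditional mean minus estimate
(`runLoss_query_sub_le`). Estimates of size t^(1/4), steps and learning rate of exponent -3/4, and
δ, ξ of order t^(-1/4) make each of the first three parts O(T^(3/4)). The first expert suffices: its
steps have the right order and its initial weight is at least 1/2, so no logarithm appears.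

Noise paired with the weighted combination has mean zero, because that point does not depend on the
current direction. The comparator is the minimiser in hindsight and may depend on all the noise, so
there Cauchy–Schwarz reduces to the norm of the summed noise. Its increments are orthogonal in L²
and of size T^(1/4), which gives T^(1/2) · T^(1/4) (`integral_norm_noiseSum_le`). Conditioning is
implemented by redrawing one direction independently (`Environment.Valid.integral_resample`). -/

namespace EnergySharing

/-! ### Deterministic tools: projection, projected descent, exponential weights, symmetric
differences. -/

section

section Projection

variable {E : Type*} [NormedAddCommGroup E] [InnerProductSpace ℝ E] [CompleteSpace E]
  {C : Set E}

/-- `proj` is a bare choice; a closed convex set in a Hilbert space has a nearest point, so the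
choice has its defining property. -/
theorem proj_spec (hne : C.Nonempty) (hcl : IsClosed C) (hcv : Convex ℝ C) (x : E) :
    proj C x ∈ C ∧ ∀ y ∈ C, dist x (proj C x) ≤ dist x y := by
  obtain ⟨v, hv, h⟩ := exists_norm_eq_iInf_of_complete_convex hne hcl.isComplete hcv x
  refine Classical.epsilon_spec (p := fun p => p ∈ C ∧ ∀ y ∈ C, dist x p ≤ dist x y)
    ⟨v, hv, fun y hy => ?_⟩
  rw [dist_eq_norm, dist_eq_norm, h]
  exact ciInf_le (f := fun w : C => ‖x - w‖) ⟨0, by rintro _ ⟨w, rfl⟩; positivity⟩ ⟨y, hy⟩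

theorem proj_inner_le_zero (hne : C.Nonempty) (hcl : IsClosed C) (hcv : Convex ℝ C) (x : E)
    {y : E} (hy : y ∈ C) : inner ℝ (x - proj C x) (y - proj C x) ≤ 0 := by
  obtain ⟨hp, hmin⟩ := proj_spec hne hcl hcv x
  refine (norm_eq_iInf_iff_real_inner_le_zero hcv hp).1 ?_ y hy
  have : Nonempty C := ⟨⟨_, hp⟩⟩
  refine le_antisymm (le_ciInf fun w => ?_)
    (ciInf_le (f := fun w : C => ‖x - w‖) ⟨0, by rintro _ ⟨w, rfl⟩; positivity⟩ ⟨_, hp⟩)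
  simpa [dist_eq_norm] using hmin w w.2

/-- The angle at the projection is obtuse, so moving to it cannot increase the distance to a point
of the set. This is the contraction used in each descent step. -/
theorem norm_proj_sub_le (hne : C.Nonempty) (hcl : IsClosed C) (hcv : Convex ℝ C) (x : E)
    {y : E} (hy : y ∈ C) : ‖proj C x - y‖ ^ 2 ≤ ‖x - y‖ ^ 2 := by
  have h := proj_inner_le_zero hne hcl hcv x hy
  have e : x - y = (x - proj C x) - (y - proj C x) := by abel
  rw [e, norm_sub_sq_real (x - proj C x), norm_sub_rev (proj C x) y]
  nlinarith [sq_nonneg ‖x - proj C x‖]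

/-- Adding the two variational inequalities shows that projection is 1-Lipschitz. Continuity is what
makes the expert points measurable. -/
theorem continuous_proj (hne : C.Nonempty) (hcl : IsClosed C) (hcv : Convex ℝ C) :
    Continuous (proj C) := by
  refine (LipschitzWith.of_dist_le_mul (K := 1) fun x y => ?_).continuous
  have hx := proj_inner_le_zero hne hcl hcv x (proj_spec hne hcl hcv y).1
  have hy := proj_inner_le_zero hne hcl hcv y (proj_spec hne hcl hcv x).1
  set p := proj C x
  set q := proj C y
  have key : ‖p - q‖ ^ 2 ≤ inner ℝ (x - y) (p - q) := by
    rw [← real_inner_self_eq_norm_sq]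
    have e1 : inner ℝ (x - p) (q - p) = - inner ℝ (x - p) (p - q) := by
      rw [← inner_neg_right, neg_sub]
    have e2 : inner ℝ (x - y) (p - q) - inner ℝ (p - q) (p - q)
        = inner ℝ (x - p) (p - q) - inner ℝ (y - q) (p - q) := by
      rw [← inner_sub_left, ← inner_sub_left]; congr 1; abel
    linarith
  have h2 := real_inner_le_norm (x - y) (p - q)
  rw [dist_eq_norm, dist_eq_norm, NNReal.coe_one, one_mul]
  rcases (norm_nonneg (p - q)).eq_or_lt with h0 | h0
  · rw [← h0]; positivity
  · exact le_of_mul_le_mul_right (by nlinarith) h0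

end Projection

/-- Projected gradient descent with time-varying feasible sets, against a moving comparator whose
path length up to any time is controlled by the decrease of `w`. -/
theorem projected_descent_regret {E : Type*} [NormedAddCommGroup E] [InnerProductSpace ℝ E]
    [CompleteSpace E] {C : ℕ → Set E} (hne : ∀ n, (C n).Nonempty) (hcl : ∀ n, IsClosed (C n))
    (hcv : ∀ n, Convex ℝ (C n)) {z c g : ℕ → E} {η w : ℕ → ℝ} {D : ℝ}
    (hstep : ∀ n, z (n + 1) = proj (C (n + 1)) (z n - η n • g n))
    (hc : ∀ n, c n ∈ C n) (hη : ∀ n, 0 < η n) (hηm : ∀ n, η (n + 1) ≤ η n)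
    (hw0 : ∀ n, 0 ≤ w n) (hzD : ∀ n m, ‖z n - c m‖ ≤ D)
    (hpath : ∀ n, ‖c n - c (n + 1)‖ ≤ w n - w (n + 1)) (T : ℕ) :
    ∑ n ∈ Finset.range T, inner ℝ (g n) (z n - c (n + 1)) ≤
      (D ^ 2 + 2 * D * w 0) / (2 * η T) + ∑ n ∈ Finset.range T, η n / 2 * ‖g n‖ ^ 2 := by
  have hD : 0 ≤ D := (norm_nonneg _).trans (hzD 0 0)
  have hwm : ∀ n, w (n + 1) ≤ w n := fun n => by
    linarith [(norm_nonneg _).trans (hpath n)]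
  -- Potential: squared distance to the current comparator plus a charge for the path it may still
  -- travel, so the comparator's motion is paid for by the decrease of `w`.
  set A : ℕ → ℝ := fun n => ‖z n - c n‖ ^ 2 + 2 * D * w n with hA
  have hAB : ∀ n, A n ≤ D ^ 2 + 2 * D * w 0 := fun n => by
    have h1 : w n ≤ w 0 := (antitone_nat_of_succ_le hwm) (Nat.zero_le n)
    have h2 : ‖z n - c n‖ ^ 2 ≤ D ^ 2 := pow_le_pow_left₀ (norm_nonneg _) (hzD n n) 2
    have h3 : 2 * D * w n ≤ 2 * D * w 0 := by gcongr
    simp only [hA]; linarith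
  have hA0 : ∀ n, 0 ≤ A n := fun n => by
    have := hw0 n
    simp only [hA]; positivity
  have hone : ∀ n, inner ℝ (g n) (z n - c (n + 1)) ≤
      (A n - A (n + 1)) / (2 * η n) + η n / 2 * ‖g n‖ ^ 2 := fun n => by
    have h1 := norm_proj_sub_le (hne (n + 1)) (hcl _) (hcv _) (z n - η n • g n) (hc (n + 1))
    rw [← hstep n] at h1
    have e : z n - η n • g n - c (n + 1) = (z n - c (n + 1)) - η n • g n := by abel
    rw [e, norm_sub_sq_real (z n - c (n + 1)), norm_smul, inner_smul_right, real_inner_comm, Real.norm_eq_abs,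
      abs_of_pos (hη n)] at h1
    have h2 : ‖z n - c (n + 1)‖ ≤ ‖z n - c n‖ + ‖c n - c (n + 1)‖ := by
      have := norm_add_le (z n - c n) (c n - c (n + 1))
      rwa [sub_add_sub_cancel] at this
    have h3 : ‖z n - c (n + 1)‖ ^ 2 ≤ ‖z n - c n‖ ^ 2 + 2 * D * (w n - w (n + 1)) := by
      have a1 := hzD n (n + 1)
      have a2 := hzD n n
      have a3 := hpath n
      have a4 : ‖z n - c (n + 1)‖ - ‖z n - c n‖ ≤ w n - w (n + 1) := by linarith
      have a5 : 0 ≤ w n - w (n + 1) := (norm_nonneg _).trans a3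
      have a6 : 0 ≤ ‖z n - c (n + 1)‖ + ‖z n - c n‖ := by positivity
      nlinarith [mul_le_mul_of_nonneg_right a4 a6]
    have hη' := hη n
    have h4 : 2 * η n * inner ℝ (g n) (z n - c (n + 1)) ≤
        A n - A (n + 1) + η n ^ 2 * ‖g n‖ ^ 2 := by
      simp only [hA]; nlinarith
    have h5 : (A n - A (n + 1)) / (2 * η n) + η n / 2 * ‖g n‖ ^ 2 =
        (A n - A (n + 1) + η n ^ 2 * ‖g n‖ ^ 2) / (2 * η n) := by
      field_simp
    rw [h5, le_div_iff₀ (by positivity)]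
    linarith
  -- Summation by parts as an induction: keeping `- A T` makes the numerator nonnegative, so the
  -- smaller step size can be put in the denominator.
  have htel : ∀ T : ℕ, ∑ n ∈ Finset.range T, (A n - A (n + 1)) / (2 * η n) ≤
      (D ^ 2 + 2 * D * w 0 - A T) / (2 * η T) := by
    intro T
    induction T with
    | zero =>
      simp only [Finset.range_zero, Finset.sum_empty]
      have := hη 0
      exact div_nonneg (by linarith [hAB 0]) (by positivity)
    | succ T ih =>
      rw [Finset.sum_range_succ]
      have h0 := hη T
      have h1 := hη (T + 1)
      calc _ ≤ (D ^ 2 + 2 * D * w 0 - A T) / (2 * η T) + (A T - A (T + 1)) / (2 * η T) := by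
            gcongr
        _ = (D ^ 2 + 2 * D * w 0 - A (T + 1)) / (2 * η T) := by ring
        _ ≤ _ := by
            apply div_le_div_of_nonneg_left _ (by positivity)
            · linarith [hηm T]
            · linarith [hAB (T + 1)]
  calc _ ≤ ∑ n ∈ Finset.range T, ((A n - A (n + 1)) / (2 * η n) + η n / 2 * ‖g n‖ ^ 2) :=
        Finset.sum_le_sum fun n _ => hone n
    _ ≤ _ := by
      rw [Finset.sum_add_distrib]
      have h := hη T
      have : (D ^ 2 + 2 * D * w 0 - A T) / (2 * η T) ≤ (D ^ 2 + 2 * D * w 0) / (2 * η T) := by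
        gcongr
        linarith [hA0 T]
      linarith [htel T]

/-- A substitute for Hoeffding's lemma, valid for all `x`, so that no smallness of the learning rate
is needed; the linear term vanishes once centred losses are averaged. -/
theorem exp_le_add_exp_sq (x : ℝ) : Real.exp x ≤ x + Real.exp (x ^ 2) := by
  have h2 := Real.add_one_le_exp (x ^ 2)
  rcases le_total |x| 1 with h | h
  · have := abs_le.1 (Real.abs_exp_sub_one_sub_id_le h)
    linarith [this.2]
  · rcases le_abs'.1 h with h' | h'
    · have : Real.exp x ≤ 1 := Real.exp_le_one_iff.2 (by linarith)
      nlinarith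
    · have : Real.exp x ≤ Real.exp (x ^ 2) := Real.exp_le_exp.2 (by nlinarith)
      linarith

/-- Exponential weights with centred losses. -/
theorem exponential_weights_regret {ι : Type*} [Fintype ι] {w x : ℕ → ι → ℝ} {ε M : ℝ}
    (hε : 0 < ε) (hpos : ∀ k, 0 < w 0 k) (hsum : ∑ k, w 0 k = 1)
    (hstep : ∀ n k, w (n + 1) k = w n k * Real.exp (-ε * x n k) /
      ∑ k', w n k' * Real.exp (-ε * x n k'))
    (hcentre : ∀ n, ∑ k, w n k = 1 → ∑ k, w n k * x n k = 0) (T : ℕ)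
    (hM : ∀ n < T, ∀ k, |x n k| ≤ M) (k₀ : ι) :
    ∑ n ∈ Finset.range T, -x n k₀ ≤ -Real.log (w 0 k₀) / ε + T * (ε * M ^ 2) := by
  have hZ : ∀ n, (∀ k, 0 < w n k) → 0 < ∑ k', w n k' * Real.exp (-ε * x n k') := fun n h =>
    Finset.sum_pos (fun k _ => mul_pos (h k) (Real.exp_pos _)) ⟨k₀, Finset.mem_univ _⟩
  have hw : ∀ n, (∀ k, 0 < w n k) ∧ ∑ k, w n k = 1 := by
    intro n
    induction n with
    | zero => exact ⟨hpos, hsum⟩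
    | succ n ih =>
      have hz := hZ n ih.1
      refine ⟨fun k => ?_, ?_⟩
      · rw [hstep]; exact div_pos (mul_pos (ih.1 k) (Real.exp_pos _)) hz
      · simp_rw [hstep]
        rw [← Finset.sum_div, div_self hz.ne']
  -- The potential is the log-weight of the chosen expert: each round adds `-ε * x` and subtracts
  -- the log of the normaliser, at most `ε ^ 2 * M ^ 2`. In the end a log-weight is at most 0.
  have hmain : ∀ m ≤ T, ε * ∑ n ∈ Finset.range m, -x n k₀ ≤
      Real.log (w m k₀) - Real.log (w 0 k₀) + m * (ε ^ 2 * M ^ 2) := by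
    intro m hm
    induction m with
    | zero => simp
    | succ m ih =>
      have hz := hZ m (hw m).1
      have hle : ∑ k', w m k' * Real.exp (-ε * x m k') ≤ Real.exp (ε ^ 2 * M ^ 2) := by
        calc _ ≤ ∑ k', w m k' * (-ε * x m k' + Real.exp (ε ^ 2 * M ^ 2)) := by
              refine Finset.sum_le_sum fun k _ => mul_le_mul_of_nonneg_left ?_ ((hw m).1 k).le
              refine (exp_le_add_exp_sq _).trans ?_
              have : (-ε * x m k) ^ 2 ≤ ε ^ 2 * M ^ 2 := by
                have h1 := hM m hm k
                have h2 : (x m k) ^ 2 ≤ M ^ 2 := sq_le_sq' (by linarith [(abs_le.1 h1).1])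
                  (abs_le.1 h1).2
                nlinarith [sq_nonneg ε]
              linarith [Real.exp_le_exp.2 this]
          _ = -ε * ∑ k', w m k' * x m k' + (∑ k', w m k') * Real.exp (ε ^ 2 * M ^ 2) := by
              rw [Finset.mul_sum, Finset.sum_mul, ← Finset.sum_add_distrib]
              exact Finset.sum_congr rfl fun k _ => by ring
          _ = _ := by rw [hcentre m (hw m).2, (hw m).2]; ring
      have hlog : Real.log (w (m + 1) k₀) = Real.log (w m k₀) + -ε * x m k₀ -
          Real.log (∑ k', w m k' * Real.exp (-ε * x m k')) := by
        rw [hstep, Real.log_div (mul_pos ((hw m).1 k₀) (Real.exp_pos _)).ne' hz.ne',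
          Real.log_mul ((hw m).1 k₀).ne' (Real.exp_pos _).ne', Real.log_exp]
      have hlz : Real.log (∑ k', w m k' * Real.exp (-ε * x m k')) ≤ ε ^ 2 * M ^ 2 := by
        rw [← Real.log_exp (ε ^ 2 * M ^ 2)]
        exact Real.log_le_log hz hle
      rw [Finset.sum_range_succ, mul_add]
      push_cast
      linarith [ih (by omega)]
  have hlogT : Real.log (w T k₀) ≤ 0 := by
    refine Real.log_nonpos ((hw T).1 k₀).le ?_
    rw [← (hw T).2]
    exact Finset.single_le_sum (fun k _ => ((hw T).1 k).le) (Finset.mem_univ k₀)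
  have h := hmain T le_rfl
  have h2 : ∑ n ∈ Finset.range T, -x n k₀ ≤
      (-Real.log (w 0 k₀) + T * (ε ^ 2 * M ^ 2)) / ε := by
    rw [le_div_iff₀ hε]; linarith
  refine h2.trans_eq ?_
  field_simp

/-- The symmetric difference quotient of a convex Lipschitz function is an approximate
subgradient. -/
theorem symm_diff_mul_le {φ : ℝ → ℝ} (hφ : ConvexOn ℝ Set.univ φ) {K : ℝ}
    (hK : ∀ a b, |φ a - φ b| ≤ K * |a - b|) (z x h : ℝ) :
    (φ (z + h) - φ (z - h)) * h * (x - z) ≤ 2 * h ^ 2 * (φ x - φ z + 2 * K * |h|) := by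
  have hK0 : 0 ≤ K := by simpa using (abs_nonneg _).trans (hK 1 0)
  suffices H : ∀ h : ℝ, 0 < h → (φ (z + h) - φ (z - h)) * h * (x - z) ≤
      2 * h ^ 2 * (φ x - φ z + 2 * K * |h|) by
    rcases lt_trichotomy h 0 with h0 | h0 | h0
    · have := H (-h) (by linarith)
      rw [← sub_eq_add_neg, sub_neg_eq_add, neg_sq, abs_neg] at this
      linarith
    · subst h0; simp
    · exact H h h0
  intro h h0
  rw [abs_of_pos h0]
  have hmid : 2 * φ z ≤ φ (z + h) + φ (z - h) := by
    have := hφ.2 (Set.mem_univ (z + h)) (Set.mem_univ (z - h))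
      (by norm_num : (0 : ℝ) ≤ 1 / 2) (by norm_num : (0 : ℝ) ≤ 1 / 2) (by norm_num)
    simp only [smul_eq_mul] at this
    rw [show 1 / 2 * (z + h) + 1 / 2 * (z - h) = z by ring] at this
    linarith
  suffices H : (φ (z + h) - φ (z - h)) * (x - z) ≤ 2 * h * (φ x - φ z + 2 * K * h) by
    nlinarith
  have hpos : 0 ≤ K * h * h := by positivity
  -- If `x` is outside the interval of radius `h` about `z`, monotonicity of chord slopes compares
  -- it with the nearer endpoint and midpoint convexity returns to `φ z`. Inside, Lipschitz bounds
  -- put everything into the error term.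
  rcases le_or_gt (z + h) x with hx | hx
  · have hs : (φ (z + h) - φ (z - h)) * (x - (z + h)) ≤ (φ x - φ (z + h)) * (2 * h) := by
      rcases hx.eq_or_lt with he | hx
      · rw [← he]; simp
      · have := hφ.slope_mono_adjacent (Set.mem_univ (z - h)) (Set.mem_univ x)
          (by linarith : z - h < z + h) hx
        rw [div_le_div_iff₀ (by linarith) (by linarith)] at this
        linarith
    nlinarith
  rcases le_or_gt x (z - h) with hx' | hx'
  · have hs : (φ (z - h) - φ x) * (2 * h) ≤ (φ (z + h) - φ (z - h)) * ((z - h) - x) := by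
      rcases hx'.eq_or_lt with he | hx'
      · rw [he]; simp
      · have := hφ.slope_mono_adjacent (Set.mem_univ x) (Set.mem_univ (z + h))
          hx' (by linarith : z - h < z + h)
        rw [div_le_div_iff₀ (by linarith) (by linarith)] at this
        linarith
    nlinarith
  · have hxz : |x - z| ≤ h := abs_le.2 ⟨by linarith, by linarith⟩
    have h1 : (φ (z + h) - φ (z - h)) * (x - z) ≤ (K * (2 * h)) * h := by
      refine (le_abs_self _).trans ?_
      rw [abs_mul]
      refine mul_le_mul ((hK _ _).trans ?_) hxz (abs_nonneg _) (by positivity)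
      rw [show z + h - (z - h) = 2 * h by ring, abs_of_pos (by linarith)]
    have h2 : φ z - φ x ≤ K * h := by
      refine (le_abs_self _).trans ((hK _ _).trans ?_)
      rw [abs_sub_comm]
      gcongr
    nlinarith

end

/-! ### The uniform law on the sphere and the mean of one-point gradient estimates. -/

section

section Sphere

variable {E : Type*} [NormedAddCommGroup E] [InnerProductSpace ℝ E]

/-- The action of a linear isometry on the unit sphere. -/
def sphereEquiv (f : E ≃ₗᵢ[ℝ] E) : Metric.sphere (0 : E) 1 ≃ₜ Metric.sphere (0 : E) 1 where
  toFun u := ⟨f u, by simp⟩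
  invFun u := ⟨f.symm u, by simp⟩
  left_inv u := by ext; simp
  right_inv u := by ext; simp
  continuous_toFun := by fun_prop
  continuous_invFun := by fun_prop

variable [FiniteDimensional ℝ E] [MeasurableSpace E] [BorelSpace E]

/-- The sphere measure of a set is, up to a constant, the volume of the cone over it; linear
isometries commute with taking cones and preserve volume. -/
theorem measurePreserving_sphereEquiv (f : E ≃ₗᵢ[ℝ] E) :
    MeasurePreserving (sphereEquiv f) (uniformSphere E) (uniformSphere E) := by
  have hm : Measurable (sphereEquiv f) := (sphereEquiv f).continuous.measurable
  have key : ((volume : Measure E).toSphere).map (sphereEquiv f) =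
      (volume : Measure E).toSphere := by
    ext s hs
    rw [Measure.map_apply hm hs, Measure.toSphere_apply' _ (hm hs), Measure.toSphere_apply' _ hs]
    congr 1
    rw [← f.measurePreserving.measure_preimage_emb f.toHomeomorph.measurableEmbedding
      (Set.Ioo (0 : ℝ) 1 • (Subtype.val '' s))]
    congr 1
    ext x
    simp only [Set.mem_smul, Set.mem_image, Set.mem_preimage]
    constructor
    · rintro ⟨r, hr, _, ⟨u, hu, rfl⟩, rfl⟩
      exact ⟨r, hr, _, ⟨_, hu, rfl⟩, by simp [sphereEquiv]⟩
    · rintro ⟨r, hr, _, ⟨u, hu, rfl⟩, h⟩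
      refine ⟨r, hr, _, ⟨(sphereEquiv f).symm u, by simpa using hu, rfl⟩, ?_⟩
      apply f.injective
      rw [map_smul, ← h]
      simp [sphereEquiv]
  refine ⟨hm, ?_⟩
  rw [uniformSphere, Measure.map_smul, key]

theorem integral_sphereEquiv (f : E ≃ₗᵢ[ℝ] E) (h : E → ℝ) :
    ∫ u : Metric.sphere (0 : E) 1, h (f u) ∂uniformSphere E =
      ∫ u : Metric.sphere (0 : E) 1, h u ∂uniformSphere E :=
  (measurePreserving_sphereEquiv f).integral_comp (sphereEquiv f).measurableEmbedding
    (fun u : Metric.sphere (0 : E) 1 => h u)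

instance isProbabilityMeasure_uniformSphere [Nontrivial E] :
    IsProbabilityMeasure (uniformSphere E) := by
  refine ⟨?_⟩
  rw [uniformSphere, Measure.smul_apply, smul_eq_mul]
  refine ENNReal.inv_mul_cancel ?_ (measure_ne_top _ _)
  rw [ne_eq, Measure.measure_univ_eq_zero]
  exact Measure.toSphere_ne_zero _

end Sphere

section Coordinates

variable {ι : Type*} [Fintype ι]

/-- Reflection of one coordinate. -/
noncomputable def reflectCoord [DecidableEq ι] (k : ι) : EuclideanSpace ℝ ι ≃ₗᵢ[ℝ] EuclideanSpace ℝ ι :=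
  LinearIsometryEquiv.piLpCongrRight 2 fun j =>
    if j = k then LinearIsometryEquiv.neg ℝ else LinearIsometryEquiv.refl ℝ ℝ

theorem reflectCoord_apply [DecidableEq ι] (k : ι) (x : EuclideanSpace ℝ ι) (j : ι) :
    reflectCoord k x j = if j = k then -x j else x j := by
  simp only [reflectCoord, LinearIsometryEquiv.piLpCongrRight_apply]
  split_ifs <;> simp

theorem integrable_sphere {F : Type*} [NormedAddCommGroup F] [Nontrivial (EuclideanSpace ℝ ι)]
    {h : EuclideanSpace ℝ ι → F} (hh : Continuous h) :
    Integrable (fun u : Metric.sphere (0 : EuclideanSpace ℝ ι) 1 => h u)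
      (uniformSphere (EuclideanSpace ℝ ι)) := by
  have hc : Continuous fun u : Metric.sphere (0 : EuclideanSpace ℝ ι) 1 => h u := by fun_prop
  exact hc.integrable_of_hasCompactSupport (HasCompactSupport.of_compactSpace _)

/-- Swapping coordinates shows that all these integrals agree, and they sum to 1 because the squared
coordinates do. -/
theorem integral_sphere_sq [Nontrivial (EuclideanSpace ℝ ι)] (k : ι) :
    ∫ u : Metric.sphere (0 : EuclideanSpace ℝ ι) 1, (u : EuclideanSpace ℝ ι) k ^ 2
      ∂uniformSphere (EuclideanSpace ℝ ι) = 1 / Fintype.card ι := by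
  classical
  set I : ι → ℝ := fun k => ∫ u : Metric.sphere (0 : EuclideanSpace ℝ ι) 1,
    (u : EuclideanSpace ℝ ι) k ^ 2 ∂uniformSphere (EuclideanSpace ℝ ι) with hI
  have h1 : ∀ j, I j = I k := fun j => by
    have := integral_sphereEquiv
      (LinearIsometryEquiv.piLpCongrLeft 2 ℝ ℝ (Equiv.swap j k)) (fun x => x k ^ 2)
    simpa [LinearIsometryEquiv.piLpCongrLeft_apply, Equiv.piCongrLeft'] using this
  have h2 : ∑ j, I j = 1 := by
    simp only [hI]
    rw [← integral_finsetSum _ fun j _ => integrable_sphere (h := fun u => u j ^ 2) (by fun_prop)]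
    have : ∀ u : Metric.sphere (0 : EuclideanSpace ℝ ι) 1,
        ∑ j, (u : EuclideanSpace ℝ ι) j ^ 2 = 1 := fun u => by
      rw [← EuclideanSpace.real_norm_sq_eq]; simp
    simp [this]
  simp only [h1, Finset.sum_const, Finset.card_univ, nsmul_eq_mul] at h2
  exact eq_one_div_of_mul_eq_one_right h2

/-- The one-point estimate of the gradient of a separable convex function is, in expectation, an
approximate subgradient. -/
theorem inner_integral_smul_le [Nontrivial (EuclideanSpace ℝ ι)]
    {f : EuclideanSpace ℝ ι → ℝ} {φ : ι → ℝ → ℝ} {A K : ℝ}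
    (hf : ∀ y, f y = A + ∑ j, φ j (y j)) (hφ : ∀ j, ConvexOn ℝ Set.univ (φ j))
    (hK : ∀ j a b, |φ j a - φ j b| ≤ K * |a - b|) {N δ : ℝ} (hN : 0 ≤ N) (hδ : 0 < δ)
    (z x : EuclideanSpace ℝ ι) :
    inner ℝ (∫ u : Metric.sphere (0 : EuclideanSpace ℝ ι) 1,
        (N / δ * f (z + δ • (u : EuclideanSpace ℝ ι))) • (u : EuclideanSpace ℝ ι)
        ∂uniformSphere (EuclideanSpace ℝ ι)) (x - z) ≤
      N / Fintype.card ι * (f x - f z + 2 * K * δ * Fintype.card ι) := by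
  classical
  set σ := uniformSphere (EuclideanSpace ℝ ι)
  have hφc : ∀ j, Continuous (φ j) := fun j => by
    have hK0 : 0 ≤ K := by simpa using (abs_nonneg _).trans (hK j 1 0)
    refine (LipschitzWith.of_dist_le_mul (K := ⟨K, hK0⟩) fun a b => ?_).continuous
    exact hK j a b
  have hK0 : Nonempty ι → 0 ≤ K := fun ⟨j⟩ => by simpa using (abs_nonneg _).trans (hK j 1 0)
  have hfc : Continuous f := by
    rw [funext hf]; fun_prop
  have hint : Integrable (fun u : Metric.sphere (0 : EuclideanSpace ℝ ι) 1 =>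
      (N / δ * f (z + δ • (u : EuclideanSpace ℝ ι))) • (u : EuclideanSpace ℝ ι)) σ :=
    integrable_sphere (h := fun u => (N / δ * f (z + δ • u)) • u) (by fun_prop)
  have hcoord : ∀ k, (x k - z k) * ∫ u : Metric.sphere (0 : EuclideanSpace ℝ ι) 1,
      N / δ * f (z + δ • (u : EuclideanSpace ℝ ι)) * (u : EuclideanSpace ℝ ι) k ∂σ ≤
      N / Fintype.card ι * (φ k (x k) - φ k (z k) + 2 * K * δ) := by
    intro k
    -- Reflecting coordinate `k` flips the sign of `u k` and fixes the other coordinates, so by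
    -- separability only `φ k` survives in the averaged integrand: its symmetric difference with
    -- half-width `δ * u k`.
    have hrefl := integral_sphereEquiv (reflectCoord k)
      (fun u => N / δ * f (z + δ • u) * u k)
    simp only [reflectCoord_apply, if_true] at hrefl
    have hi1 : Integrable (fun u : Metric.sphere (0 : EuclideanSpace ℝ ι) 1 =>
        N / δ * f (z + δ • (u : EuclideanSpace ℝ ι)) * (u : EuclideanSpace ℝ ι) k) σ :=
      integrable_sphere (h := fun u => N / δ * f (z + δ • u) * u k) (by fun_prop)
    have hi2 : Integrable (fun u : Metric.sphere (0 : EuclideanSpace ℝ ι) 1 =>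
        N / δ * f (z + δ • reflectCoord k (u : EuclideanSpace ℝ ι)) *
          -(u : EuclideanSpace ℝ ι) k) σ :=
      integrable_sphere (h := fun u => N / δ * f (z + δ • reflectCoord k u) * -u k)
        (by have := (reflectCoord k).continuous; fun_prop)
    have hi3 : Integrable (fun u : Metric.sphere (0 : EuclideanSpace ℝ ι) 1 =>
        N * (φ k (x k) - φ k (z k) + 2 * K * δ) * (u : EuclideanSpace ℝ ι) k ^ 2) σ :=
      integrable_sphere (h := fun u => N * (φ k (x k) - φ k (z k) + 2 * K * δ) * u k ^ 2)
        (by fun_prop)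
    -- The half-width contributes the factor `u k ^ 2`, whose mean `1 / card ι` is the source of the
    -- normalisation in the result.
    have hpt : ∀ u : Metric.sphere (0 : EuclideanSpace ℝ ι) 1,
        (x k - z k) * ((N / δ * f (z + δ • (u : EuclideanSpace ℝ ι)) *
            (u : EuclideanSpace ℝ ι) k +
          N / δ * f (z + δ • reflectCoord k (u : EuclideanSpace ℝ ι)) *
            -(u : EuclideanSpace ℝ ι) k) / 2) ≤
        N * (φ k (x k) - φ k (z k) + 2 * K * δ) * (u : EuclideanSpace ℝ ι) k ^ 2 := by
      intro u
      set v : EuclideanSpace ℝ ι := (u : EuclideanSpace ℝ ι)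
      have hv : |v k| ≤ 1 := by
        have h1 := PiLp.norm_apply_le v k
        have h2 : ‖v‖ = 1 := by simp [v]
        rwa [h2, Real.norm_eq_abs] at h1
      have hdiff : f (z + δ • v) - f (z + δ • reflectCoord k v) =
          φ k (z k + δ * v k) - φ k (z k - δ * v k) := by
        rw [hf, hf, add_sub_add_left_eq_sub, ← Finset.sum_sub_distrib, Finset.sum_eq_single k]
        · simp [reflectCoord_apply, sub_eq_add_neg]
        · intro j _ hj
          simp [reflectCoord_apply, hj]
        · simp
      have hs := symm_diff_mul_le (hφ k) (hK k) (z k) (x k) (δ * v k)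
      have hb : |δ * v k| ≤ δ := by
        rw [abs_mul, abs_of_pos hδ]; exact mul_le_of_le_one_right hδ.le hv
      have hs2 : (φ k (z k + δ * v k) - φ k (z k - δ * v k)) * (δ * v k) * (x k - z k) ≤
          2 * (δ * v k) ^ 2 * (φ k (x k) - φ k (z k) + 2 * K * δ) := by
        refine hs.trans ?_
        have := hK0 ⟨k⟩
        gcongr
      calc _ = N / (2 * δ ^ 2) * ((φ k (z k + δ * v k) - φ k (z k - δ * v k)) *
            (δ * v k) * (x k - z k)) := by
            rw [← hdiff]; field_simp; ring
        _ ≤ N / (2 * δ ^ 2) * (2 * (δ * v k) ^ 2 * (φ k (x k) - φ k (z k) + 2 * K * δ)) := by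
            gcongr
        _ = _ := by field_simp
    have hmono := integral_mono (((hi1.add hi2).div_const 2).const_mul (x k - z k)) hi3 hpt
    rw [integral_const_mul, integral_div] at hmono
    simp only [Pi.add_apply] at hmono
    rw [integral_add hi1 hi2, hrefl, add_self_div_two, integral_const_mul,
      integral_sphere_sq] at hmono
    refine hmono.trans_eq (by ring)
  have hsum := Finset.sum_le_sum fun k (_ : k ∈ Finset.univ) => hcoord k
  rw [← Finset.mul_sum, Finset.sum_add_distrib, Finset.sum_sub_distrib] at hsum
  have hL : inner ℝ (∫ u : Metric.sphere (0 : EuclideanSpace ℝ ι) 1,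
        (N / δ * f (z + δ • (u : EuclideanSpace ℝ ι))) • (u : EuclideanSpace ℝ ι) ∂σ) (x - z) =
      ∑ k, (x k - z k) * ∫ u : Metric.sphere (0 : EuclideanSpace ℝ ι) 1,
        N / δ * f (z + δ • (u : EuclideanSpace ℝ ι)) * (u : EuclideanSpace ℝ ι) k ∂σ := by
    rw [PiLp.inner_apply]
    refine Finset.sum_congr rfl fun k _ => ?_
    have := (EuclideanSpace.proj (𝕜 := ℝ) k).integral_comp_comm hint
    simp only [PiLp.proj_apply, PiLp.smul_apply, smul_eq_mul] at this
    rw [this]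
    simp
  rw [hL]
  refine hsum.trans_eq ?_
  rw [hf x, hf z]
  simp only [Finset.sum_const, Finset.card_univ, nsmul_eq_mul]
  ring

end Coordinates

end

/-! ### Geometry of the action sets and measurability of the run. -/

section

section Feasible

variable {V : Type*} [Fintype V] [DecidableEq V] {G : SimpleGraph V} [DecidableRel G.Adj]
  {P : Params G}

theorem mem_closedNbhd_self (i : V) : i ∈ closedNbhd G i := Finset.mem_insert_self _ _

theorem mem_closedNbhd_comm {i j : V} : i ∈ closedNbhd G j ↔ j ∈ closedNbhd G i := by
  simp [closedNbhd, eq_comm, G.adj_comm]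

theorem Params.Valid.nontrivial_action (hP : P.Valid) (i : V) : Nontrivial (Action G i) := by
  obtain ⟨j, hj⟩ := (G.degree_pos_iff_exists_adj i).1 (hP.degree_pos i)
  have : Nonempty (closedNbhd G i) := ⟨⟨i, mem_closedNbhd_self i⟩⟩
  infer_instance

theorem Params.Valid.nonempty (hP : P.Valid) (i : V) : (P.X i).Nonempty := by
  obtain ⟨c, hc⟩ := hP.inner i
  exact ⟨c, hc (Metric.mem_closedBall_self (hP.r_pos i).le)⟩

theorem Params.Valid.isCompact (hP : P.Valid) (i : V) : IsCompact (P.X i) := by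
  obtain ⟨c, hc⟩ := hP.outer i
  exact (isCompact_closedBall c (P.R i)).of_isClosed_subset (hP.closed i) hc

theorem Params.Valid.isClosed_smul (hP : P.Valid) (i : V) (c : ℝ) : IsClosed (c • P.X i) :=
  ((hP.isCompact i).smul c).isClosed

theorem Params.Valid.convex_smul (hP : P.Valid) (i : V) (c : ℝ) : Convex ℝ (c • P.X i) :=
  (hP.convex i).smul c

/-- A ball of positive radius in a nontrivial space does not fit into a single point. Positivity of
`R` makes exploration radii and step sizes positive. -/
theorem Params.Valid.R_pos (hP : P.Valid) (i : V) : 0 < P.R i := by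
  have := hP.nontrivial_action i
  obtain ⟨c, hc⟩ := hP.outer i
  obtain ⟨c', hc'⟩ := hP.inner i
  obtain ⟨v, hv⟩ := exists_norm_eq (Action G i) (hP.r_pos i).le
  by_contra! hR
  have hr := hP.r_pos i
  have h1 : dist c' c ≤ P.R i := hc (hc' (Metric.mem_closedBall_self hr.le))
  have h2 : dist (c' + v) c ≤ P.R i := hc (hc' (by simp [hv]))
  have e1 : c' = c := dist_le_zero.1 (h1.trans hR)
  have e2 : c' + v = c := dist_le_zero.1 (h2.trans hR)
  have : v = 0 := by rw [e1] at e2; simpa using e2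
  rw [this, norm_zero] at hv
  linarith

end Feasible

section Measurability

variable {V : Type*} [Fintype V] [DecidableEq V] {G : SimpleGraph V} [DecidableRel G.Adj]
  {α : Type*} [MeasurableSpace α]

theorem measurable_amount {k : V} {y : α → Action G k} (hy : Measurable y) (j : V) :
    Measurable fun a => amount (y a) j := by
  unfold amount
  split_ifs <;> fun_prop

theorem measurable_adjust {i : V} {d : α → ℝ} {y : α → Action G i} (hd : Measurable d)
    (hy : Measurable y) : Measurable fun a => adjust (d a) (y a) := by
  have hs : Measurable fun a => ∑ j ∈ closedNbhd G i, amount (y a) j :=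
    Finset.measurable_fun_sum _ fun j _ => measurable_amount hy j
  exact Measurable.ite (measurableSet_lt hd hs) ((hd.div hs).smul hy) hy

theorem measurable_loss (l : V → ℝ) {x : α → ∀ k, Action G k}
    (hx : ∀ k, Measurable fun a => x a k) (i : V) : Measurable fun a => loss l (x a) i := by
  unfold loss satisfaction
  refine measurable_const.sub (measurable_const.mul (Finset.measurable_fun_sum _ fun j _ => ?_))
  exact ((Finset.measurable_fun_sum _ fun k _ => measurable_amount (hx k) j).div_const _).min
    measurable_const

theorem measurable_constr {i : V} {d : α → ℝ} {y : α → Action G i} (hd : Measurable d)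
    (hy : Measurable y) : Measurable fun a => constr (d a) (y a) :=
  (Finset.measurable_fun_sum _ fun j _ => measurable_amount hy j).sub hd

/-- Componentwise measurability of a random state. -/
structure State.Meas {K : ℕ} (s : α → State G K) : Prop where
  point : ∀ i k, Measurable fun a => (s a).point i k
  weight : ∀ i k, Measurable fun a => (s a).weight i k
  dual : ∀ i, Measurable fun a => (s a).dual i

namespace State.Meas

variable {K : ℕ} {s : α → State G K} {P : Params G} {t : ℕ} {l : V → ℝ}
  {d : V → α → ℝ} {u : ∀ i, α → Action G i}

theorem center (hs : State.Meas s) (i : V) : Measurable fun a => (s a).center i :=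
  Finset.measurable_fun_sum _ fun k _ => (hs.weight i k).smul (hs.point i k)

theorem query (hs : State.Meas s) (hu : ∀ i, Measurable (u i)) (i : V) :
    Measurable fun a => (s a).query P t (fun k => u k a) i :=
  (hs.center i).add ((hu i).const_smul (P.delta i t))

theorem played (hs : State.Meas s) (hd : ∀ i, Measurable (d i)) (hu : ∀ i, Measurable (u i)) (i : V) :
    Measurable fun a => (s a).played P t (fun k => d k a) (fun k => u k a) i :=
  measurable_adjust (hd i) (hs.query hu i)

theorem ownLoss (hs : State.Meas s) (hd : ∀ i, Measurable (d i)) (hu : ∀ i, Measurable (u i)) (i : V)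
    {y : α → Action G i} (hy : Measurable y) :
    Measurable fun a => (s a).ownLoss P t l (fun k => d k a) (fun k => u k a) i (y a) := by
  refine measurable_loss l (fun k => ?_) i
  by_cases h : k = i
  · subst h; simpa using hy
  · simpa [h] using hs.played hd hu k

theorem gradLoss (hs : State.Meas s) (hd : ∀ i, Measurable (d i)) (hu : ∀ i, Measurable (u i)) (i : V) :
    Measurable fun a => (s a).gradLoss P t l (fun k => d k a) (fun k => u k a) i :=
  ((hs.ownLoss hd hu i (hs.query hu i)).const_mul _).smul (hu i)

theorem gradConstr (hs : State.Meas s) (hd : ∀ i, Measurable (d i)) (hu : ∀ i, Measurable (u i)) (i : V) :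
    Measurable fun a => (s a).gradConstr P t (fun k => d k a) (fun k => u k a) i :=
  ((measurable_constr (hd i) (hs.query hu i)).const_mul _).smul (hu i)

theorem nextDual (hs : State.Meas s) (hd : ∀ i, Measurable (d i)) (hu : ∀ i, Measurable (u i)) (i : V) :
    Measurable fun a => (s a).nextDual P t (fun k => d k a) (fun k => u k a) i :=
  ((hs.dual i).add (((measurable_constr (hd i) (hs.played hd hu i)).sub
    ((hs.dual i).const_mul _)).const_mul _)).max measurable_const

theorem surrogate (hs : State.Meas s) (hd : ∀ i, Measurable (d i)) (hu : ∀ i, Measurable (u i)) (i : V)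
    {y : α → Action G i} (hy : Measurable y) :
    Measurable fun a => (s a).surrogate P t l (fun k => d k a) (fun k => u k a) i (y a) :=
  (hs.gradLoss hd hu i).inner (hy.sub (hs.center i))

theorem next (hs : State.Meas s) (hP : P.Valid) (ε : ℝ) (hd : ∀ i, Measurable (d i)) (hu : ∀ i, Measurable (u i)) :
    State.Meas fun a => (s a).next P ε t l (fun k => d k a) (fun k => u k a) where
  point i k := (continuous_proj ((hP.nonempty i).smul_set) (hP.isClosed_smul i _)
    (hP.convex_smul i _)).measurable.comp ((hs.point i k).sub
      (Measurable.fun_const_smul (Measurable.fun_add (hs.gradLoss hd hu i)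
        (Measurable.fun_smul (hs.nextDual hd hu i) (hs.gradConstr hd hu i))) _))
  weight i k := by
    have h : ∀ k, Measurable fun a => (s a).weight i k * Real.exp (-ε *
        (s a).surrogate P t l (fun k => d k a) (fun k => u k a) i ((s a).point i k)) := fun k =>
      (hs.weight i k).mul
        (Real.measurable_exp.comp ((hs.surrogate hd hu i (hs.point i k)).const_mul _))
    exact (h k).div (Finset.measurable_fun_sum _ fun k _ => h k)
  dual i := hs.nextDual hd hu i

end State.Meas

theorem measurable_run {P : Params G} (hP : P.Valid) (K : ℕ) (ε : ℝ) (l : ℕ → V → ℝ)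
    {d : ℕ → V → α → ℝ} {u : ℕ → ∀ i, α → Action G i} {z₀ : ∀ i, α → Action G i}
    (hd : ∀ t i, Measurable (d t i)) (hu : ∀ t i, Measurable (u t i))
    (hz : ∀ i, Measurable (z₀ i)) (n : ℕ) :
    State.Meas fun a =>
      run P K ε l (fun t k => d t k a) (fun t k => u t k a) (fun k => z₀ k a) n := by
  induction n with
  | zero => exact ⟨fun i _ => hz i, fun _ _ => measurable_const, fun _ => measurable_const⟩
  | succ n ih => exact ih.next hP ε (hd (n + 1)) (hu (n + 1))

end Measurability

end

/-! ### The loss of a node as a function of its own allocation. -/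

section

variable {V : Type*} [Fintype V] [DecidableEq V] {G : SimpleGraph V} [DecidableRel G.Adj]

section Loss

theorem amount_of_mem {k : V} (y : Action G k) {j : V} (h : j ∈ closedNbhd G k) :
    amount y j = y ⟨j, h⟩ := dif_pos h

theorem abs_amount_le {k : V} (y : Action G k) (j : V) : |amount y j| ≤ ‖y‖ := by
  unfold amount
  split_ifs with h
  · simpa using PiLp.norm_apply_le y ⟨j, h⟩
  · simp

theorem amount_smul {k : V} (c : ℝ) (y : Action G k) (j : V) :
    amount (c • y) j = c * amount y j := by
  unfold amount
  split_ifs <;> simp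

theorem norm_adjust_le {i : V} {d : ℝ} (hd : 0 ≤ d) (y : Action G i) : ‖adjust d y‖ ≤ ‖y‖ := by
  unfold adjust
  split_ifs with h
  · rw [norm_smul, Real.norm_of_nonneg (div_nonneg hd (hd.trans h.le))]
    exact mul_le_of_le_one_left (norm_nonneg _) (div_le_one_of_le₀ h.le (hd.trans h.le))
  · exact le_rfl

/-- This keeps the dual variable at 0 throughout the run. -/
theorem constr_adjust_nonpos {i : V} {d : ℝ} (hd : 0 ≤ d) (y : Action G i) :
    constr d (adjust d y) ≤ 0 := by
  unfold constr adjust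
  split_ifs with h
  · simp_rw [amount_smul, ← Finset.mul_sum]
    rw [div_mul_cancel₀ _ (hd.trans_lt h).ne', sub_self]
  · linarith

theorem card_closedNbhd_pos (i : V) : (0 : ℝ) < (closedNbhd G i).card :=
  Nat.cast_pos.2 (Finset.card_pos.2 ⟨i, mem_closedNbhd_self i⟩)

theorem concaveOn_min_div (b : ℝ) (l : ℝ) :
    ConcaveOn ℝ Set.univ fun s : ℝ => min ((s + b) / l) 1 := by
  refine ⟨convex_univ, fun x _ y _ a c ha hc hac => ?_⟩
  simp only [smul_eq_mul]
  have h1 := min_le_left ((x + b) / l) 1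
  have h2 := min_le_left ((y + b) / l) 1
  have h3 := min_le_right ((x + b) / l) 1
  have h4 := min_le_right ((y + b) / l) 1
  refine le_min ?_ (by nlinarith)
  have e : (a * x + c * y + b) / l = a * ((x + b) / l) + c * ((y + b) / l) := by
    rw [← eq_sub_iff_add_eq] at hac
    rw [hac]; ring
  rw [e]
  nlinarith

theorem abs_min_div_sub_le {L l : ℝ} (hL : 0 < L) (hl : 1 / L ≤ l) (b p q : ℝ) :
    |min ((p + b) / l) 1 - min ((q + b) / l) 1| ≤ L * |p - q| := by
  have hl0 : 0 < l := (by positivity : 0 < 1 / L).trans_le hl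
  refine (abs_min_sub_min_le_max _ _ _ _).trans ?_
  rw [sub_self, abs_zero, ← sub_div, add_sub_add_right_eq_sub, abs_div, abs_of_pos hl0]
  refine max_le ?_ (by positivity)
  rw [div_le_iff₀ hl0]
  have : 1 ≤ L * l := by rwa [div_le_iff₀' hL] at hl
  nlinarith [abs_nonneg (p - q)]

end Loss

namespace State

variable {K : ℕ} (s : State G K) (P : Params G) (t : ℕ) (l d : V → ℝ) (u : ∀ i, Action G i)

/-- What the nodes other than `i` send to `j`. -/
noncomputable def received (i j : V) : ℝ :=
  ∑ k ∈ (closedNbhd G j).erase i, amount (s.played P t d u k) j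

/-- Satisfaction of `j` sees `y` only through its coordinate at `j`, and symmetry of the graph puts
`i` among the senders of each such `j`. The loss is thus separable, the other nodes entering only as
shifts. -/
theorem ownLoss_eq (i : V) (y : Action G i) :
    s.ownLoss P t l d u i y = 1 + ∑ j : closedNbhd G i,
      -(1 / ((closedNbhd G i).card : ℝ) * min ((y j + s.received P t d u i j) / l j) 1) := by
  unfold ownLoss loss satisfaction
  rw [Finset.sum_neg_distrib, ← Finset.mul_sum, ← sub_eq_add_neg, ← Finset.sum_coe_sort]
  congr 2
  refine Finset.sum_congr rfl fun j _ => ?_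
  have hi : i ∈ closedNbhd G j := mem_closedNbhd_comm.2 j.2
  rw [← Finset.add_sum_erase _ _ hi, Function.update_self, amount_of_mem y j.2, received]
  congr 3
  refine Finset.sum_congr rfl fun k hk => ?_
  rw [Function.update_of_ne (Finset.ne_of_mem_erase hk)]

/-- The action that node `i` plays is overwritten by `y`, and the other nodes' actions use their own
directions. Hence the loss function is fixed while `u i` is averaged out. -/
theorem ownLoss_update (i : V) (v y : Action G i) :
    s.ownLoss P t l d (Function.update u i v) i y = s.ownLoss P t l d u i y := by
  unfold ownLoss
  congr 1
  ext1 k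
  by_cases h : k = i
  · subst h; simp
  · simp [h, played, query]

variable {P l}

theorem abs_ownLoss_sub_le (hP : P.Valid) (hl : ∀ j, 1 / P.L ≤ l j) (i : V) (y y' : Action G i) :
    |s.ownLoss P t l d u i y - s.ownLoss P t l d u i y'| ≤ P.L * ‖y - y'‖ := by
  have hn := card_closedNbhd_pos (G := G) i
  rw [ownLoss_eq, ownLoss_eq, add_sub_add_left_eq_sub, ← Finset.sum_sub_distrib]
  refine (Finset.abs_sum_le_sum_abs _ _).trans ?_
  calc _ ≤ ∑ _j : closedNbhd G i, 1 / ((closedNbhd G i).card : ℝ) * (P.L * ‖y - y'‖) := by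
        refine Finset.sum_le_sum fun j _ => ?_
        rw [neg_sub_neg, ← mul_sub, abs_mul, abs_of_pos (by positivity), abs_sub_comm]
        refine mul_le_mul_of_nonneg_left ?_ (by positivity)
        refine (abs_min_div_sub_le hP.L_pos (hl j) _ _ _).trans ?_
        have := PiLp.norm_apply_le (y - y') j
        have hL := hP.L_pos
        gcongr
        simpa using this
    _ = _ := by
        rw [Finset.sum_const, Finset.card_univ, Fintype.card_coe, nsmul_eq_mul]
        field_simp

/-- Perturbed points can leave the action sets, so losses are bounded through the norms of the
allocations and the lower bound on demands. -/
theorem abs_ownLoss_le (hP : P.Valid) (hl : ∀ j, 1 / P.L ≤ l j) (hd : ∀ j, 0 ≤ d j) {W : ℝ}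
    (hW : ∀ k, ‖s.query P t u k‖ ≤ W) (i : V) {y : Action G i} (hy : ‖y‖ ≤ W) :
    |s.ownLoss P t l d u i y| ≤ 2 + P.L * (Fintype.card V * W) := by
  have hn := card_closedNbhd_pos (G := G) i
  have hL := hP.L_pos
  have hW0 : 0 ≤ W := (norm_nonneg _).trans hy
  unfold ownLoss loss
  set x := Function.update (s.played P t d u) i y with hx
  have hxW : ∀ k, ‖x k‖ ≤ W := fun k => by
    by_cases h : k = i
    · subst h; simpa [hx] using hy
    · rw [hx, Function.update_of_ne h]
      exact (norm_adjust_le (hd k) _).trans (hW k)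
  have hsat : ∀ j, |satisfaction l x j| ≤ 1 + P.L * (Fintype.card V * W) := fun j => by
    have hl0 : 0 < l j := (by positivity : 0 < 1 / P.L).trans_le (hl j)
    have hS : |∑ k ∈ closedNbhd G j, amount (x k) j| ≤ Fintype.card V * W := by
      calc _ ≤ ∑ k ∈ closedNbhd G j, |amount (x k) j| := Finset.abs_sum_le_sum_abs _ _
        _ ≤ ∑ _k ∈ closedNbhd G j, W :=
            Finset.sum_le_sum fun k _ => (abs_amount_le _ _).trans (hxW k)
        _ = (closedNbhd G j).card * W := by rw [Finset.sum_const, nsmul_eq_mul]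
        _ ≤ _ := by gcongr; exact Finset.card_le_univ _
    have hq : |(∑ k ∈ closedNbhd G j, amount (x k) j) / l j| ≤ P.L * (Fintype.card V * W) := by
      rw [abs_div, abs_of_pos hl0, div_le_iff₀ hl0]
      have : 1 ≤ P.L * l j := by have := hl j; rwa [div_le_iff₀' hL] at this
      have h0 : 0 ≤ Fintype.card V * W := by positivity
      nlinarith
    unfold satisfaction
    have := abs_min_sub_min_le_max ((∑ k ∈ closedNbhd G j, amount (x k) j) / l j) 1 0 0
    have h2 : |(1 : ℝ)| = 1 := abs_one
    rw [min_self, sub_zero, sub_zero, sub_zero, h2] at this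
    refine this.trans (max_le ?_ ?_)
    · linarith
    · have : 0 ≤ P.L * (Fintype.card V * W) := by positivity
      linarith
  have hsum : |1 / ((closedNbhd G i).card : ℝ) * ∑ j ∈ closedNbhd G i, satisfaction l x j| ≤
      1 + P.L * (Fintype.card V * W) := by
    rw [abs_mul, abs_of_pos (by positivity : 0 < 1 / ((closedNbhd G i).card : ℝ)),
      one_div_mul_eq_div, div_le_iff₀ hn]
    refine (Finset.abs_sum_le_sum_abs _ _).trans ((Finset.sum_le_sum fun j _ => hsat j).trans_eq ?_)
    rw [Finset.sum_const, nsmul_eq_mul, mul_comm]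
  have := abs_sub 1 (1 / ((closedNbhd G i).card : ℝ) * ∑ j ∈ closedNbhd G i, satisfaction l x j)
  rw [abs_one] at this
  linarith

variable (P l) in
/-- Conditional mean of the gradient estimate of node `i`, given all the rest. -/
noncomputable def gradMean (i : V) : Action G i :=
  ∫ v : Metric.sphere (0 : Action G i) 1, ((Fintype.card V : ℝ) / P.delta i t *
    s.ownLoss P t l d u i (s.center i + P.delta i t • (v : Action G i))) • (v : Action G i)
    ∂uniformSphere (Action G i)

/-- Each coordinate function has Lipschitz constant `L` divided by the dimension, so the error terms
add up to `2 * L * δ`. The prefactor is the ratio of the estimator's scale to the dimension. -/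
theorem inner_gradMean_le (hP : P.Valid) (hl : ∀ j, 1 / P.L ≤ l j) (i : V)
    (hδ : 0 < P.delta i t) (y : Action G i) :
    inner ℝ (s.gradMean P t l d u i) (y - s.center i) ≤
      (Fintype.card V : ℝ) / (closedNbhd G i).card *
        (s.ownLoss P t l d u i y - s.ownLoss P t l d u i (s.center i)
          + 2 * P.L * P.delta i t) := by
  have hn := card_closedNbhd_pos (G := G) i
  have := hP.nontrivial_action i
  have hκ : 0 < 1 / ((closedNbhd G i).card : ℝ) := by positivity
  have h := inner_integral_smul_le (f := s.ownLoss P t l d u i) (A := 1)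
    (φ := fun j x => -(1 / ((closedNbhd G i).card : ℝ) *
      min ((x + s.received P t d u i j) / l j) 1))
    (K := 1 / ((closedNbhd G i).card : ℝ) * P.L)
    (s.ownLoss_eq P t l d u i)
    (fun j => ((concaveOn_min_div (s.received P t d u i j) (l j)).smul hκ.le).neg)
    (fun j a b => by
      rw [neg_sub_neg, ← mul_sub, abs_mul, abs_of_pos hκ, abs_sub_comm, mul_assoc]
      exact mul_le_mul_of_nonneg_left (abs_min_div_sub_le hP.L_pos (hl j) _ _ _) hκ.le)
    (N := Fintype.card V) (by positivity) hδ (s.center i) y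
  rw [Fintype.card_coe] at h
  refine h.trans_eq ?_
  field_simp

theorem norm_gradLoss_le {M : ℝ} {i : V} (hδ : 0 < P.delta i t) (hu : ‖u i‖ = 1)
    (hM : |s.ownLoss P t l d u i (s.query P t u i)| ≤ M) :
    ‖s.gradLoss P t l d u i‖ ≤ Fintype.card V / P.delta i t * M := by
  unfold gradLoss
  rw [norm_smul, hu, mul_one, Real.norm_eq_abs, abs_mul, abs_of_nonneg (by positivity)]
  gcongr

theorem center_mem (hw : ∀ i k, 0 ≤ s.weight i k) (hw1 : ∀ i, ∑ k, s.weight i k = 1)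
    {C : ∀ i, Set (Action G i)} (hC : ∀ i, Convex ℝ (C i)) (hp : ∀ i k, s.point i k ∈ C i)
    (i : V) : s.center i ∈ C i :=
  (hC i).sum_mem (fun k _ => hw i k) (hw1 i) fun k _ => hp i k

/-- Surrogates are measured from the weighted mean of the points, which supplies the centring
hypothesis of exponential weights. -/
theorem sum_weight_mul_surrogate (i : V) (hw : ∑ k, s.weight i k = 1) :
    ∑ k, s.weight i k * s.surrogate P t l d u i (s.point i k) = 0 := by
  have : ∑ k, s.weight i k * s.surrogate P t l d u i (s.point i k) =
      inner ℝ (s.gradLoss P t l d u i)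
        (∑ k, (s.weight i k • s.point i k - s.weight i k • s.center i)) := by
    rw [inner_sum]
    refine Finset.sum_congr rfl fun k _ => ?_
    rw [surrogate, ← smul_sub, inner_smul_right]
  rw [this, Finset.sum_sub_distrib, ← Finset.sum_smul, hw, one_smul, center, sub_self,
    inner_zero_right]

end State

end

/-! ### Growth rates of the parameters and deterministic bounds along a run. -/

section

variable {V : Type*} [Fintype V] [DecidableEq V] {G : SimpleGraph V} [DecidableRel G.Adj]
  {P : Params G}

section Rates

theorem Params.Valid.Ltilde_pos (hP : P.Valid) (i : V) : 0 < P.Ltilde i := by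
  have := hP.L_pos
  have := hP.R_pos i
  have := hP.r_pos i
  unfold Params.Ltilde
  positivity

theorem Params.Valid.delta_pos (hP : P.Valid) (i : V) {t : ℕ} (ht : 1 ≤ t) : 0 < P.delta i t := by
  have := hP.Ltilde_pos i
  have := hP.R_pos i
  have := hP.F_pos i
  have : (0 : ℝ) < G.degree i := Nat.cast_pos.2 (hP.degree_pos i)
  have : (0 : ℝ) < t := Nat.cast_pos.2 ht
  unfold Params.delta
  positivity

theorem Params.delta_eq (i : V) (t : ℕ) :
    P.delta i t = P.delta i 1 * (t : ℝ) ^ (-(1 / 4) : ℝ) := by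
  have h : (P.R i ^ 2 / 2 / (t : ℝ)) ^ (1 / 4 : ℝ) =
      (P.R i ^ 2 / 2) ^ (1 / 4 : ℝ) / (t : ℝ) ^ (1 / 4 : ℝ) :=
    Real.div_rpow (by positivity) (by positivity) _
  unfold Params.delta
  rw [h, Real.rpow_neg (by positivity), Nat.cast_one, div_one, mul_assoc,
    div_eq_mul_inv ((P.R i ^ 2 / 2) ^ (1 / 4 : ℝ))]

theorem Params.Valid.delta_anti (hP : P.Valid) (i : V) {s t : ℕ} (hs : 1 ≤ s) (h : s ≤ t) :
    P.delta i t ≤ P.delta i s := by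
  rw [P.delta_eq i t, P.delta_eq i s]
  have : (0 : ℝ) < s := Nat.cast_pos.2 hs
  refine mul_le_mul_of_nonneg_left ?_ (hP.delta_pos i le_rfl).le
  exact Real.rpow_le_rpow_of_nonpos this (Nat.cast_le.2 h) (by norm_num)

theorem Params.Valid.xi_anti (hP : P.Valid) (i : V) {s t : ℕ} (hs : 1 ≤ s) (h : s ≤ t) :
    P.xi i t ≤ P.xi i s :=
  div_le_div_of_nonneg_right (hP.delta_anti i hs h) (hP.r_pos i).le

theorem Params.Valid.xi_pos (hP : P.Valid) (i : V) {t : ℕ} (ht : 1 ≤ t) : 0 < P.xi i t :=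
  div_pos (hP.delta_pos i ht) (hP.r_pos i)

/-- In early rounds `xi` may exceed 1 and the shrinking factor may be negative; only its absolute
value is controlled. -/
theorem Params.Valid.abs_one_sub_xi_le (hP : P.Valid) (i : V) {t : ℕ} (ht : 1 ≤ t) :
    |1 - P.xi i t| ≤ 1 + P.xi i 1 := by
  have h1 := hP.xi_anti i le_rfl ht
  have h2 := hP.xi_pos i ht
  exact abs_le.2 ⟨by linarith, by linarith⟩

theorem Params.eta_eq (i : V) (k t : ℕ) :
    P.eta i k t = P.eta i k 1 * (t : ℝ) ^ (-(3 / 4) : ℝ) := by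
  unfold Params.eta
  simp

theorem Params.Valid.eta_pos (hP : P.Valid) (i : V) (k : ℕ) {t : ℕ} (ht : 1 ≤ t) :
    0 < P.eta i k t := by
  have := hP.Ltilde_pos i
  have := hP.R_pos i
  have := hP.F_pos i
  have : (0 : ℝ) < G.degree i := Nat.cast_pos.2 (hP.degree_pos i)
  have : (0 : ℝ) < t := Nat.cast_pos.2 ht
  unfold Params.eta
  positivity

theorem Params.Valid.eta_anti (hP : P.Valid) (i : V) (k : ℕ) {s t : ℕ} (hs : 1 ≤ s) (h : s ≤ t) :
    P.eta i k t ≤ P.eta i k s := by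
  rw [P.eta_eq i k t, P.eta_eq i k s]
  have : (0 : ℝ) < s := Nat.cast_pos.2 hs
  refine mul_le_mul_of_nonneg_left ?_ (hP.eta_pos i k le_rfl).le
  exact Real.rpow_le_rpow_of_nonpos this (Nat.cast_le.2 h) (by norm_num)

theorem Params.gamma_nonneg (i : V) (t : ℕ) : 0 ≤ P.gamma i t := by
  unfold Params.gamma
  positivity

theorem sum_rpow_neg_quarter_le (T : ℕ) :
    ∑ n ∈ Finset.range T, ((n : ℝ) + 1) ^ (-(1 / 4) : ℝ) ≤ 2 * (T : ℝ) ^ (3 / 4 : ℝ) := by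
  induction T with
  | zero => simp
  | succ T ih =>
    rw [Finset.sum_range_succ]
    push_cast
    set r := (T : ℝ) ^ (1 / 4 : ℝ)
    set s := ((T : ℝ) + 1) ^ (1 / 4 : ℝ)
    have hT : (0 : ℝ) ≤ T := by positivity
    have hr : 0 ≤ r := by positivity
    have hs : 0 < s := by positivity
    have hrs : r ≤ s := Real.rpow_le_rpow hT (by linarith) (by norm_num)
    have e1 : (T : ℝ) ^ (3 / 4 : ℝ) = r ^ 3 := by
      rw [← Real.rpow_natCast, ← Real.rpow_mul hT]; norm_num
    have e2 : ((T : ℝ) + 1) ^ (3 / 4 : ℝ) = s ^ 3 := by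
      rw [← Real.rpow_natCast, ← Real.rpow_mul (by positivity)]; norm_num
    have e3 : ((T : ℝ) + 1) ^ (-(1 / 4) : ℝ) = s⁻¹ := Real.rpow_neg (by positivity) _
    have e4 : r ^ 4 = T := by
      rw [← Real.rpow_natCast, ← Real.rpow_mul hT]; norm_num
    have e5 : s ^ 4 = T + 1 := by
      rw [← Real.rpow_natCast, ← Real.rpow_mul (by positivity)]; norm_num
    rw [e1] at ih
    rw [e2, e3]
    -- With `r`, `s` the fourth roots of `T` and `T + 1`, the increment bound is a polynomial
    -- inequality under `s ^ 4 - r ^ 4 = 1`.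
    have h : s⁻¹ ≤ 2 * (s ^ 3 - r ^ 3) := by
      rw [inv_le_iff_one_le_mul₀ hs]
      have h1 : 1 = s ^ 4 - r ^ 4 := by rw [e4, e5]; ring
      have h2 : 2 * (s ^ 3 - r ^ 3) * s - (s ^ 4 - r ^ 4) =
          (s - r) * ((s ^ 3 - r ^ 3) + s ^ 2 * r + s * r ^ 2) := by ring
      have h3 : r ^ 3 ≤ s ^ 3 := pow_le_pow_left₀ hr hrs 3
      have h4 : 0 ≤ (s - r) * ((s ^ 3 - r ^ 3) + s ^ 2 * r + s * r ^ 2) :=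
        mul_nonneg (by linarith) (by have : 0 ≤ s ^ 3 - r ^ 3 := by linarith
                                     positivity)
      linarith
    linarith

end Rates

/-- Deterministic assumptions on a realisation of the inputs. -/
structure GoodInput (P : Params G) (l d : ℕ → V → ℝ) (u : ℕ → ∀ i, Action G i)
    (z₀ : ∀ i, Action G i) : Prop where
  demand : ∀ t j, 1 / P.L ≤ l t j
  generation : ∀ t j, 0 ≤ d t j
  norm_u : ∀ t i, ‖u t i‖ = 1
  start : ∀ i, z₀ i ∈ (1 - P.xi i 1) • P.X i

/-- `W` bounds all points that occur in a run. -/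
def IsRadius (P : Params G) (W : ℝ) : Prop :=
  0 ≤ W ∧ ∀ i, ∀ y ∈ P.X i, (1 + P.xi i 1) * ‖y‖ + P.delta i 1 ≤ W

theorem Params.Valid.exists_isRadius (hP : P.Valid) : ∃ W, IsRadius P W := by
  choose B hB using fun i => (hP.isCompact i).isBounded.exists_norm_le
  refine ⟨∑ i, |(1 + P.xi i 1) * B i + P.delta i 1|, by positivity, fun i y hy => ?_⟩
  have := hP.xi_pos i le_rfl
  calc _ ≤ (1 + P.xi i 1) * B i + P.delta i 1 := by gcongr; exact hB i y hy
    _ ≤ |(1 + P.xi i 1) * B i + P.delta i 1| := le_abs_self _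
    _ ≤ _ := Finset.single_le_sum (f := fun i => |(1 + P.xi i 1) * B i + P.delta i 1|)
      (fun _ _ => abs_nonneg _) (Finset.mem_univ i)

theorem IsRadius.norm_add_delta_le {W : ℝ} (hW : IsRadius P W) (hP : P.Valid) {i : V} {t : ℕ}
    (ht : 1 ≤ t) {y : Action G i} (hy : y ∈ (1 - P.xi i t) • P.X i) :
    ‖y‖ + P.delta i t ≤ W := by
  obtain ⟨x, hx, rfl⟩ := hy
  have h1 := hP.abs_one_sub_xi_le i ht
  have h2 := hP.delta_anti i le_rfl ht
  have h3 := hW.2 i x hx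
  have h4 : ‖(1 - P.xi i t) • x‖ ≤ (1 + P.xi i 1) * ‖x‖ := by
    rw [norm_smul, Real.norm_eq_abs]; gcongr
  simp only at *
  linarith

theorem IsRadius.norm_le {W : ℝ} (hW : IsRadius P W) (hP : P.Valid) {i : V} {y : Action G i}
    (hy : y ∈ P.X i) : (1 + P.xi i 1) * ‖y‖ ≤ W := by
  linarith [hW.2 i y hy, hP.delta_pos i le_rfl]

theorem IsRadius.norm_le' {W : ℝ} (hW : IsRadius P W) (hP : P.Valid) {i : V} {y : Action G i}
    (hy : y ∈ P.X i) : ‖y‖ ≤ W := by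
  nlinarith [hW.norm_le hP hy, norm_nonneg y, hP.xi_pos i le_rfl]

section Run

variable {K : ℕ} {ε : ℝ} {l d : ℕ → V → ℝ} {u : ℕ → ∀ i, Action G i} {z₀ : ∀ i, Action G i}

theorem State.nextDual_eq_zero {s : State G K} {t : ℕ} {d : V → ℝ} {u : ∀ i, Action G i} {i : V}
    (hs : s.dual i = 0) (hd : 0 ≤ d i) : s.nextDual P t d u i = 0 := by
  unfold State.nextDual
  rw [hs, mul_zero, sub_zero, zero_add]
  exact max_eq_right (mul_nonpos_of_nonneg_of_nonpos (P.gamma_nonneg i _)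
    (constr_adjust_nonpos hd _))

theorem run_dual (h : GoodInput P l d u z₀) (i : V) (n : ℕ) :
    (run P K ε l d u z₀ n).dual i = 0 := by
  induction n with
  | zero => rfl
  | succ n ih => exact State.nextDual_eq_zero ih (h.generation _ i)

/-- With a zero multiplier the constraint estimate drops out, leaving plain projected descent on the
loss estimates. -/
theorem run_point_succ (h : GoodInput P l d u z₀) (i : V) (k : Fin K) (n : ℕ) :
    (run P K ε l d u z₀ (n + 1)).point i k = proj ((1 - P.xi i (n + 2)) • P.X i)
      ((run P K ε l d u z₀ n).point i k - P.eta i k (n + 2) •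
        (run P K ε l d u z₀ n).gradLoss P (n + 1) (l (n + 1)) (d (n + 1)) (u (n + 1)) i) := by
  rw [run, State.next]
  dsimp only
  rw [State.nextDual_eq_zero (run_dual h i n) (h.generation _ i), zero_smul, add_zero]

theorem run_point_mem (hP : P.Valid) (h : GoodInput P l d u z₀) (i : V) (k : Fin K) (n : ℕ) :
    (run P K ε l d u z₀ n).point i k ∈ (1 - P.xi i (n + 1)) • P.X i := by
  cases n with
  | zero => exact h.start i
  | succ n =>
    exact (proj_spec ((hP.nonempty i).smul_set) (hP.isClosed_smul i _) (hP.convex_smul i _) _).1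

theorem sum_init_weight (K : ℕ) (hK : 0 < K) :
    ∑ k : Fin K, ((K : ℝ) + 1) / K * (1 / (((k : ℝ) + 1) * ((k : ℝ) + 2))) = 1 := by
  -- The terms telescope, being differences of consecutive reciprocals.
  have h : ∀ K : ℕ, ∑ k ∈ Finset.range K, (1 / (((k : ℝ) + 1) * ((k : ℝ) + 2))) =
      K / ((K : ℝ) + 1) := by
    intro K
    induction K with
    | zero => simp
    | succ K ih =>
      rw [Finset.sum_range_succ, ih]
      push_cast
      field_simp
      ring
  rw [← Finset.mul_sum, Fin.sum_univ_eq_sum_range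
    (fun k => 1 / (((k : ℝ) + 1) * ((k : ℝ) + 2))), h]
  have : (0 : ℝ) < K := Nat.cast_pos.2 hK
  field_simp

theorem run_weight (hK : 0 < K) (i : V) (n : ℕ) :
    (∀ k, 0 < (run P K ε l d u z₀ n).weight i k) ∧
      ∑ k, (run P K ε l d u z₀ n).weight i k = 1 := by
  induction n with
  | zero =>
    have : (0 : ℝ) < K := Nat.cast_pos.2 hK
    exact ⟨fun k => by simp only [run, State.init]; positivity, sum_init_weight K hK⟩
  | succ n ih =>
    set s := run P K ε l d u z₀ n
    have hz : 0 < ∑ k', s.weight i k' * Real.exp (-ε * s.surrogate P (n + 1) (l (n + 1))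
        (d (n + 1)) (u (n + 1)) i (s.point i k')) :=
      Finset.sum_pos (fun k _ => mul_pos (ih.1 k) (Real.exp_pos _)) ⟨⟨0, hK⟩, Finset.mem_univ _⟩
    refine ⟨fun k => div_pos (mul_pos (ih.1 k) (Real.exp_pos _)) hz, ?_⟩
    change ∑ k, _ / _ = _
    rw [← Finset.sum_div]
    exact div_self hz.ne'

theorem run_center_mem (hP : P.Valid) (hK : 0 < K) (h : GoodInput P l d u z₀) (i : V) (n : ℕ) :
    (run P K ε l d u z₀ n).center i ∈ (1 - P.xi i (n + 1)) • P.X i :=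
  State.center_mem _ (fun i k => ((run_weight hK i n).1 k).le) (fun i => (run_weight hK i n).2)
    (fun i => hP.convex_smul i _) (fun i k => run_point_mem hP h i k n) i

variable {W : ℝ}

theorem norm_run_query_le (hP : P.Valid) (hW : IsRadius P W) (hK : 0 < K)
    (h : GoodInput P l d u z₀) (i : V) (n : ℕ) :
    ‖(run P K ε l d u z₀ n).query P (n + 1) (u (n + 1)) i‖ ≤ W := by
  refine le_trans ?_ (hW.norm_add_delta_le hP (Nat.le_add_left 1 n) (run_center_mem (ε := ε) hP hK h i n))
  refine (norm_add_le _ _).trans_eq ?_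
  rw [norm_smul, h.norm_u, mul_one, Real.norm_of_nonneg (hP.delta_pos i (Nat.le_add_left 1 n)).le]

theorem norm_run_center_le (hP : P.Valid) (hW : IsRadius P W) (hK : 0 < K)
    (h : GoodInput P l d u z₀) (i : V) (n : ℕ) :
    ‖(run P K ε l d u z₀ n).center i‖ ≤ W := by
  linarith [hW.norm_add_delta_le hP (Nat.le_add_left 1 n) (run_center_mem (ε := ε) hP hK h i n),
    hP.delta_pos i (Nat.le_add_left 1 n)]

theorem norm_run_point_le (hP : P.Valid) (hW : IsRadius P W)
    (h : GoodInput P l d u z₀) (i : V) (k : Fin K) (n : ℕ) :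
    ‖(run P K ε l d u z₀ n).point i k‖ ≤ W := by
  linarith [hW.norm_add_delta_le hP (Nat.le_add_left 1 n) (run_point_mem (ε := ε) hP h i k n),
    hP.delta_pos i (Nat.le_add_left 1 n)]

variable (P W) in
/-- Bound on all losses that occur in a run. -/
noncomputable def lossBound : ℝ := 2 + P.L * (Fintype.card V * W)

variable (P W) in
/-- Scale of the gradient estimates. -/
noncomputable def gradBound (i : V) : ℝ := Fintype.card V / P.delta i 1 * lossBound P W

theorem lossBound_nonneg (hP : P.Valid) (hW : IsRadius P W) : 0 ≤ lossBound P W := by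
  have := hP.L_pos
  have := hW.1
  unfold lossBound
  positivity

theorem gradBound_nonneg (hP : P.Valid) (hW : IsRadius P W) (i : V) : 0 ≤ gradBound P W i := by
  have := lossBound_nonneg hP hW
  have := hP.delta_pos i le_rfl
  unfold gradBound
  positivity

theorem abs_run_ownLoss_le (hP : P.Valid) (hW : IsRadius P W) (hK : 0 < K)
    (h : GoodInput P l d u z₀) (i : V) (n : ℕ) {y : Action G i} (hy : ‖y‖ ≤ W) :
    |(run P K ε l d u z₀ n).ownLoss P (n + 1) (l (n + 1)) (d (n + 1)) (u (n + 1)) i y| ≤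
      lossBound P W :=
  State.abs_ownLoss_le _ _ _ _ hP (h.demand _) (h.generation _)
    (fun k => norm_run_query_le hP hW hK h k n) i hy

/-- Losses are bounded, and dividing by an exploration radius of order `t ^ (-1/4)` produces the
growth. -/
theorem norm_run_gradLoss_le (hP : P.Valid) (hW : IsRadius P W) (hK : 0 < K)
    (h : GoodInput P l d u z₀) (i : V) (n : ℕ) :
    ‖(run P K ε l d u z₀ n).gradLoss P (n + 1) (l (n + 1)) (d (n + 1)) (u (n + 1)) i‖ ≤
      gradBound P W i * ((n : ℝ) + 1) ^ (1 / 4 : ℝ) := by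
  have hδ := hP.delta_pos i (Nat.le_add_left 1 n)
  refine (State.norm_gradLoss_le _ _ _ _ hδ (h.norm_u _ i)
    (abs_run_ownLoss_le hP hW hK h i n (norm_run_query_le hP hW hK h i n))).trans_eq ?_
  have := hP.delta_pos i le_rfl
  rw [P.delta_eq i (n + 1), Real.rpow_neg (by positivity), gradBound]
  push_cast
  field_simp

end Run

end

/-! ### Pathwise regret bound with explicit noise terms. -/

section

variable {V : Type*} [Fintype V] [DecidableEq V] {G : SimpleGraph V} [DecidableRel G.Adj]

section Pathwise

variable (P : Params G) (K : ℕ) (ε : ℝ) (l d : ℕ → V → ℝ) (u : ℕ → ∀ i, Action G i)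
  (z₀ : ∀ i, Action G i)

/-- The loss function of node `i` in round `n + 1`. -/
noncomputable def runLoss (n : ℕ) (i : V) (y : Action G i) : ℝ :=
  (run P K ε l d u z₀ n).ownLoss P (n + 1) (l (n + 1)) (d (n + 1)) (u (n + 1)) i y

/-- The point of node `i` in round `n + 1`. -/
noncomputable def runQuery (n : ℕ) (i : V) : Action G i :=
  (run P K ε l d u z₀ n).query P (n + 1) (u (n + 1)) i

/-- The gradient estimate of node `i` in round `n + 1`. -/
noncomputable def runGrad (n : ℕ) (i : V) : Action G i :=
  (run P K ε l d u z₀ n).gradLoss P (n + 1) (l (n + 1)) (d (n + 1)) (u (n + 1)) i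

/-- The conditional mean of the gradient estimate of node `i` in round `n + 1`. -/
noncomputable def runMean (n : ℕ) (i : V) : Action G i :=
  (run P K ε l d u z₀ n).gradMean P (n + 1) (l (n + 1)) (d (n + 1)) (u (n + 1)) i

/-- The error of the gradient estimate of node `i` in round `n + 1`. -/
noncomputable def runNoise (n : ℕ) (i : V) : Action G i :=
  runMean P K ε l d u z₀ n i - runGrad P K ε l d u z₀ n i

variable {P K ε l d u z₀} {W : ℝ}

theorem norm_runGrad_le (hP : P.Valid) (hW : IsRadius P W) (hK : 0 < K)
    (h : GoodInput P l d u z₀) (i : V) {n T : ℕ} (hn : n < T) :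
    ‖runGrad P K ε l d u z₀ n i‖ ≤ gradBound P W i * (T : ℝ) ^ (1 / 4 : ℝ) := by
  refine (norm_run_gradLoss_le hP hW hK h i n).trans ?_
  refine mul_le_mul_of_nonneg_left ?_ (gradBound_nonneg hP hW i)
  exact Real.rpow_le_rpow (by positivity) (by exact_mod_cast hn) (by norm_num)

theorem rpow_succ_le {T : ℕ} (hT : 1 ≤ T) (c : ℕ) :
    ((T : ℝ) + c) ^ (3 / 4 : ℝ) ≤ (c + 1) * (T : ℝ) ^ (3 / 4 : ℝ) := by
  have h1 : (1 : ℝ) ≤ T := Nat.one_le_cast.2 hT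
  have hc : (0 : ℝ) ≤ c := Nat.cast_nonneg c
  calc ((T : ℝ) + c) ^ (3 / 4 : ℝ) ≤ ((c + 1) * (T : ℝ)) ^ (3 / 4 : ℝ) :=
        Real.rpow_le_rpow (by positivity) (by nlinarith) (by norm_num)
    _ = ((c : ℝ) + 1) ^ (3 / 4 : ℝ) * (T : ℝ) ^ (3 / 4 : ℝ) :=
        Real.mul_rpow (by positivity) (by positivity)
    _ ≤ _ := by
        refine mul_le_mul_of_nonneg_right ?_ (by positivity)
        exact Real.rpow_le_self_of_one_le (by linarith) (by norm_num)

/-- Exponent count 1 - 3/4 + 2/4 = 3/4: the second-order term of exponential weights over `T`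
rounds. -/
theorem mul_rpow_quarter_sq {T : ℕ} (hT : 1 ≤ T) (a : ℝ) :
    (T : ℝ) * ((T : ℝ) ^ (-(3 / 4) : ℝ) * (a * (T : ℝ) ^ (1 / 4 : ℝ)) ^ 2) =
      a ^ 2 * (T : ℝ) ^ (3 / 4 : ℝ) := by
  have h1 : (0 : ℝ) < T := Nat.cast_pos.2 hT
  have e : ((T : ℝ) ^ (1 / 4 : ℝ)) ^ 2 = (T : ℝ) ^ (1 / 2 : ℝ) := by
    rw [← Real.rpow_natCast, ← Real.rpow_mul h1.le]; norm_num
  have e2 : (T : ℝ) * ((T : ℝ) ^ (-(3 / 4) : ℝ) * (T : ℝ) ^ (1 / 2 : ℝ)) =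
      (T : ℝ) ^ (3 / 4 : ℝ) := by
    nth_rewrite 1 [← Real.rpow_one (T : ℝ)]
    rw [← Real.rpow_add h1, ← Real.rpow_add h1]; norm_num
  rw [mul_pow, e, ← e2]
  ring

/-- Regret of the weighted combination against the first expert. -/
theorem sum_inner_center_sub_point_le (hP : P.Valid) (hW : IsRadius P W) (hK : 0 < K)
    (h : GoodInput P l d u z₀) (i : V) {T : ℕ} (hT : 1 ≤ T)
    (hε : ε = ((T : ℝ) + 1) ^ (-(3 / 4) : ℝ)) :
    ∑ n ∈ Finset.range T, inner ℝ (runGrad P K ε l d u z₀ n i)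
        ((run P K ε l d u z₀ n).center i - (run P K ε l d u z₀ n).point i ⟨0, hK⟩) ≤
      (2 + (2 * gradBound P W i * W) ^ 2) * (T : ℝ) ^ (3 / 4 : ℝ) := by
  have hT0 : (0 : ℝ) < T := Nat.cast_pos.2 hT
  have hε0 : 0 < ε := by rw [hε]; positivity
  set A := gradBound P W i
  have hA : 0 ≤ A := gradBound_nonneg hP hW i
  have hW0 := hW.1
  set s := run P K ε l d u z₀
  have key := exponential_weights_regret (w := fun n => (s n).weight i)
    (x := fun n k => (s n).surrogate P (n + 1) (l (n + 1)) (d (n + 1)) (u (n + 1)) i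
      ((s n).point i k))
    (M := 2 * A * W * (T : ℝ) ^ (1 / 4 : ℝ)) hε0 (run_weight hK i 0).1 (run_weight hK i 0).2
    (fun n k => rfl) (fun n hn => State.sum_weight_mul_surrogate _ _ _ _ i hn) T
    (fun n hn k => by
      refine (abs_real_inner_le_norm _ _).trans ?_
      have h1 := norm_runGrad_le (ε := ε) hP hW hK h i hn
      have h2 : ‖(s n).point i k - (s n).center i‖ ≤ 2 * W := by
        refine (norm_sub_le _ _).trans ?_
        linarith [norm_run_point_le (ε := ε) hP hW h i k n,
          norm_run_center_le (ε := ε) hP hW hK h i n]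
      calc _ ≤ (A * (T : ℝ) ^ (1 / 4 : ℝ)) * (2 * W) :=
            mul_le_mul h1 h2 (norm_nonneg _) (by positivity)
        _ = _ := by ring) ⟨0, hK⟩
  calc _ = ∑ n ∈ Finset.range T, -(s n).surrogate P (n + 1) (l (n + 1)) (d (n + 1)) (u (n + 1)) i
        ((s n).point i ⟨0, hK⟩) := by
        refine Finset.sum_congr rfl fun n _ => ?_
        rw [State.surrogate, ← inner_neg_right, neg_sub]; rfl
    _ ≤ _ := key
    _ ≤ 2 * (T : ℝ) ^ (3 / 4 : ℝ) + (2 * A * W) ^ 2 * (T : ℝ) ^ (3 / 4 : ℝ) := by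
        refine add_le_add ?_ ?_
        · have hKr : (1 : ℝ) ≤ K := Nat.one_le_cast.2 hK
          -- The first initial weight is `(K + 1) / (2 * K)`, so competing with the first expert
          -- costs at most `log 2` whatever the number of experts.
          have hw : (1 : ℝ) / 2 ≤ (s 0).weight i ⟨0, hK⟩ := by
            change (1 : ℝ) / 2 ≤ ((K : ℝ) + 1) / K *
              (1 / ((((0 : ℕ) : ℝ) + 1) * (((0 : ℕ) : ℝ) + 2)))
            rw [Nat.cast_zero, zero_add, zero_add, one_mul]
            refine le_mul_of_one_le_left (by norm_num) ?_
            rw [one_le_div (by linarith)]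
            linarith
          have hlog : -Real.log ((s 0).weight i ⟨0, hK⟩) ≤ 1 := by
            have h1 := Real.log_le_log (by norm_num) hw
            rw [one_div, Real.log_inv] at h1
            linarith [Real.log_two_lt_d9]
          have h2 := rpow_succ_le hT 1
          push_cast at h2
          have h3 : 1 / ε = ((T : ℝ) + 1) ^ (3 / 4 : ℝ) := by
            rw [hε, Real.rpow_neg (by positivity), one_div, inv_inv]
          calc _ ≤ 1 / ε := by gcongr
            _ ≤ _ := by rw [h3]; linarith
        · rw [← mul_rpow_quarter_sq hT]
          have : ε ≤ (T : ℝ) ^ (-(3 / 4) : ℝ) := by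
            rw [hε]
            exact Real.rpow_le_rpow_of_nonpos hT0 (by linarith) (by norm_num)
          gcongr
    _ = _ := by ring

variable (P W) in
/-- Constant in the regret bound of a single expert. -/
noncomputable def descentConst (i : V) (k : ℕ) : ℝ :=
  3 * ((2 * W) ^ 2 + 2 * (2 * W) * (P.xi i 1 * W)) / (2 * P.eta i k 1) +
    P.eta i k 1 * gradBound P W i ^ 2

/-- Regret of a single expert against shrunken copies of a fixed action. -/
theorem sum_inner_point_sub_le (hP : P.Valid) (hW : IsRadius P W) (hK : 0 < K)
    (h : GoodInput P l d u z₀) (i : V) (k : Fin K) {T : ℕ} (hT : 1 ≤ T) {x : Action G i}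
    (hx : x ∈ P.X i) :
    ∑ n ∈ Finset.range T, inner ℝ (runGrad P K ε l d u z₀ n i)
        ((run P K ε l d u z₀ n).point i k - (1 - P.xi i (n + 2)) • x) ≤
      descentConst P W i k * (T : ℝ) ^ (3 / 4 : ℝ) := by
  set A := gradBound P W i with hAdef
  have hA : 0 ≤ A := gradBound_nonneg hP hW i
  have hW0 := hW.1
  have hη1 := hP.eta_pos i k le_rfl
  have hxW := hW.norm_le' hP hx
  have hξ1 := hP.xi_pos i le_rfl
  -- The update of round `n + 1` projects onto the set of round `n + 2`, hence the shifts. As `xi`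
  -- decreases, the shrunken comparators have a telescoping path, with `xi * W` as the remaining
  -- length.
  have key := projected_descent_regret (C := fun n => (1 - P.xi i (n + 1)) • P.X i)
    (z := fun n => (run P K ε l d u z₀ n).point i k) (c := fun n => (1 - P.xi i (n + 1)) • x)
    (g := fun n => runGrad P K ε l d u z₀ n i) (η := fun n => P.eta i k (n + 2))
    (w := fun n => P.xi i (n + 1) * W) (D := 2 * W)
    (fun n => (hP.nonempty i).smul_set) (fun n => hP.isClosed_smul i _)
    (fun n => hP.convex_smul i _) (fun n => run_point_succ h i k n)
    (fun n => Set.smul_mem_smul_set hx) (fun n => hP.eta_pos i k (Nat.le_add_left 1 (n + 1)))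
    (fun n => hP.eta_anti i k (Nat.le_add_left 1 (n + 1)) (Nat.le_succ _))
    (fun n => mul_nonneg (hP.xi_pos i (Nat.le_add_left 1 n)).le hW0)
    (fun n m => by
      refine (norm_sub_le _ _).trans ?_
      have h1 := norm_run_point_le (ε := ε) hP hW h i k n
      have h2 : ‖(1 - P.xi i (m + 1)) • x‖ ≤ W := by
        rw [norm_smul, Real.norm_eq_abs]
        refine le_trans ?_ (hW.norm_le hP hx)
        gcongr
        exact hP.abs_one_sub_xi_le i (Nat.le_add_left 1 m)
      linarith)
    (fun n => by
      have h1 := hP.xi_anti i (Nat.le_add_left 1 n) (Nat.le_succ (n + 1))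
      beta_reduce
      rw [← sub_smul, norm_smul, Real.norm_eq_abs, abs_sub_comm, sub_sub_sub_cancel_left,
        abs_of_nonneg (by linarith), ← sub_mul]
      exact mul_le_mul_of_nonneg_left hxW (by linarith)) T
  refine key.trans ?_
  rw [descentConst, add_mul, ← hAdef]
  refine add_le_add ?_ ?_
  · have h2 := rpow_succ_le hT 2
    push_cast at h2
    have e : (1 : ℝ) / P.eta i k (T + 2) = ((T : ℝ) + 2) ^ (3 / 4 : ℝ) / P.eta i k 1 := by
      rw [P.eta_eq i k (T + 2), Real.rpow_neg (by positivity)]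
      push_cast
      field_simp
    set B := (2 * W) ^ 2 + 2 * (2 * W) * (P.xi i 1 * W)
    have hB : 0 ≤ B := by positivity
    calc _ = B / 2 * (1 / P.eta i k (T + 2)) := by
          simp only [B]; ring
      _ ≤ B / 2 * (3 * (T : ℝ) ^ (3 / 4 : ℝ) / P.eta i k 1) := by
          rw [e]; gcongr; linarith
      _ = _ := by field_simp
  -- Step size times squared estimate has exponent -3/4 + 2/4 = -1/4; monotonicity replaces the
  -- index `n + 2` of the step by `n + 1`.
  · calc _ ≤ ∑ n ∈ Finset.range T,
          P.eta i k 1 * A ^ 2 / 2 * ((n : ℝ) + 1) ^ (-(1 / 4) : ℝ) := by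
          refine Finset.sum_le_sum fun n _ => ?_
          have h1 := norm_run_gradLoss_le (ε := ε) hP hW hK h i n
          have h2 := hP.eta_anti i k (Nat.le_add_left 1 n) (Nat.le_succ (n + 1))
          rw [P.eta_eq i k (n + 1)] at h2
          have hn : (0 : ℝ) < (n : ℝ) + 1 := by positivity
          have e : ((n : ℝ) + 1) ^ (-(3 / 4) : ℝ) * (((n : ℝ) + 1) ^ (1 / 4 : ℝ)) ^ 2 =
              ((n : ℝ) + 1) ^ (-(1 / 4) : ℝ) := by
            rw [← Real.rpow_natCast, ← Real.rpow_mul hn.le, ← Real.rpow_add hn]; norm_num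
          push_cast at h2
          calc _ ≤ (P.eta i k 1 * ((n : ℝ) + 1) ^ (-(3 / 4) : ℝ)) / 2 *
                (A * ((n : ℝ) + 1) ^ (1 / 4 : ℝ)) ^ 2 := by
                refine mul_le_mul (by linarith) (pow_le_pow_left₀ (norm_nonneg _) h1 2)
                  (by positivity) (by positivity)
            _ = _ := by rw [← e]; ring
      _ ≤ P.eta i k 1 * A ^ 2 / 2 * (2 * (T : ℝ) ^ (3 / 4 : ℝ)) := by
          rw [← Finset.mul_sum]
          exact mul_le_mul_of_nonneg_left (sum_rpow_neg_quarter_le T) (by positivity)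
      _ = _ := by ring

variable (P W) in
/-- Constant in the pathwise regret bound. -/
noncomputable def pathConst (i : V) : ℝ :=
  ((closedNbhd G i).card : ℝ) / Fintype.card V *
    (2 + (2 * gradBound P W i * W) ^ 2 + descentConst P W i 0) +
    2 * (3 * P.L * P.delta i 1 + P.L * P.xi i 1 * W)

theorem card_pos_of_node {V : Type*} [Fintype V] (i : V) : (0 : ℝ) < Fintype.card V :=
  Nat.cast_pos.2 (Fintype.card_pos_iff.2 ⟨i⟩)

/-- Lipschitz continuity passes from the query to the centre and from `x` to its shrunken copy;
between these the conditional mean acts as an approximate subgradient and is split into estimate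
plus noise. The point `p` is arbitrary and will be the first expert. The shrinking factor is put on
the noise so that a fixed `x` factors out of the sum over rounds. -/
theorem runLoss_query_sub_le (hP : P.Valid) (hW : IsRadius P W)
    (h : GoodInput P l d u z₀) (i : V) (n : ℕ) {x : Action G i} (hx : x ∈ P.X i)
    (p : Action G i) :
    runLoss P K ε l d u z₀ n i (runQuery P K ε l d u z₀ n i) - runLoss P K ε l d u z₀ n i x ≤
      ((closedNbhd G i).card : ℝ) / Fintype.card V *
        (inner ℝ (runGrad P K ε l d u z₀ n i) ((run P K ε l d u z₀ n).center i - p) +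
          inner ℝ (runGrad P K ε l d u z₀ n i) (p - (1 - P.xi i (n + 2)) • x) +
          inner ℝ (runNoise P K ε l d u z₀ n i) ((run P K ε l d u z₀ n).center i) -
          inner ℝ ((1 - P.xi i (n + 2)) • runNoise P K ε l d u z₀ n i) x) +
        (3 * P.L * P.delta i 1 + P.L * P.xi i 1 * W) * ((n : ℝ) + 1) ^ (-(1 / 4) : ℝ) := by
  have hδ := hP.delta_pos i (Nat.le_add_left 1 n)
  have hL := hP.L_pos
  have hN := card_pos_of_node i
  have hn := card_closedNbhd_pos (G := G) i
  set z := (run P K ε l d u z₀ n).center i with hz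
  set c := (1 - P.xi i (n + 2)) • x with hc
  set g := runGrad P K ε l d u z₀ n i
  set f := runLoss P K ε l d u z₀ n i
  have h1 : f (runQuery P K ε l d u z₀ n i) - f z ≤ P.L * P.delta i (n + 1) := by
    refine (le_abs_self _).trans ((State.abs_ownLoss_sub_le _ _ _ _ hP (h.demand _) i _ _).trans ?_)
    rw [runQuery, State.query, ← hz, add_sub_cancel_left, norm_smul, h.norm_u, mul_one,
      Real.norm_of_nonneg hδ.le]
  have h2 : f c - f x ≤ P.L * (P.xi i (n + 1) * W) := by
    refine (le_abs_self _).trans ((State.abs_ownLoss_sub_le _ _ _ _ hP (h.demand _) i _ _).trans ?_)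
    have h4 := hP.xi_pos i (Nat.le_add_left 1 (n + 1))
    have h3 := hP.xi_anti i (Nat.le_add_left 1 n) (Nat.le_succ (n + 1))
    have : c - x = -(P.xi i (n + 2) • x) := by rw [hc, sub_smul, one_smul]; abel
    rw [this, norm_neg, norm_smul, Real.norm_of_nonneg h4.le]
    have h5 := hP.xi_pos i (Nat.le_add_left 1 n)
    have := hW.norm_le' hP hx
    gcongr
  have h3 := State.inner_gradMean_le (run P K ε l d u z₀ n) (n + 1) (d (n + 1)) (u (n + 1)) hP
    (h.demand (n + 1)) i hδ c
  change inner ℝ (runMean P K ε l d u z₀ n i) (c - z) ≤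
    _ * (f c - f z + 2 * P.L * P.delta i (n + 1)) at h3
  have e1 : inner ℝ g (z - p) + inner ℝ g (p - c) + inner ℝ (runNoise P K ε l d u z₀ n i) z -
      inner ℝ ((1 - P.xi i (n + 2)) • runNoise P K ε l d u z₀ n i) x =
      -inner ℝ (runMean P K ε l d u z₀ n i) (c - z) := by
    rw [real_inner_smul_left, ← real_inner_smul_right, ← hc, runNoise]
    simp only [inner_sub_left, inner_sub_right]
    ring
  have h4 : f z - f c - 2 * P.L * P.delta i (n + 1) ≤
      ((closedNbhd G i).card : ℝ) / Fintype.card V *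
        -inner ℝ (runMean P K ε l d u z₀ n i) (c - z) := by
    have := mul_le_mul_of_nonneg_left h3
      (by positivity : 0 ≤ ((closedNbhd G i).card : ℝ) / Fintype.card V)
    rw [← mul_assoc, div_mul_div_cancel₀ hN.ne', div_self hn.ne', one_mul] at this
    linarith
  rw [e1]
  have e2 : (3 * P.L * P.delta i 1 + P.L * P.xi i 1 * W) * ((n : ℝ) + 1) ^ (-(1 / 4) : ℝ) =
      3 * P.L * P.delta i (n + 1) + P.L * (P.xi i (n + 1) * W) := by
    rw [Params.xi, Params.xi, P.delta_eq i (n + 1)]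
    push_cast
    ring
  rw [e2]
  linarith

/-- Pathwise regret bound, up to the errors of the gradient estimates. -/
theorem sum_runLoss_sub_le (hP : P.Valid) (hW : IsRadius P W) (hK : 0 < K)
    (h : GoodInput P l d u z₀) (i : V) {T : ℕ} (hT : 1 ≤ T)
    (hε : ε = ((T : ℝ) + 1) ^ (-(3 / 4) : ℝ)) {x : Action G i} (hx : x ∈ P.X i) :
    ∑ n ∈ Finset.range T, runLoss P K ε l d u z₀ n i (runQuery P K ε l d u z₀ n i) -
        ∑ n ∈ Finset.range T, runLoss P K ε l d u z₀ n i x ≤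
      pathConst P W i * (T : ℝ) ^ (3 / 4 : ℝ) +
        ((closedNbhd G i).card : ℝ) / Fintype.card V *
          (∑ n ∈ Finset.range T,
              inner ℝ (runNoise P K ε l d u z₀ n i) ((run P K ε l d u z₀ n).center i) +
            W * ‖∑ n ∈ Finset.range T,
              (1 - P.xi i (n + 2)) • runNoise P K ε l d u z₀ n i‖) := by
  have hN := card_pos_of_node i
  have hn := card_closedNbhd_pos (G := G) i
  have hL := hP.L_pos
  have hδ := hP.delta_pos i le_rfl
  have hξ := hP.xi_pos i le_rfl
  have hW0 := hW.1
  have hsum := Finset.sum_le_sum fun n (_ : n ∈ Finset.range T) =>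
    runLoss_query_sub_le (K := K) (ε := ε) hP hW h i n hx
      ((run P K ε l d u z₀ n).point i ⟨0, hK⟩)
  rw [Finset.sum_sub_distrib, Finset.sum_add_distrib, ← Finset.mul_sum, ← Finset.mul_sum,
    Finset.sum_sub_distrib, Finset.sum_add_distrib, Finset.sum_add_distrib, ← sum_inner] at hsum
  have h1 := sum_inner_center_sub_point_le hP hW hK h i hT hε
  have h2 := sum_inner_point_sub_le (ε := ε) hP hW hK h i ⟨0, hK⟩ hT hx
  -- Cauchy–Schwarz after summation makes the bound uniform in `x`, as required for a minimiser that
  -- may depend on all the randomness.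
  have h3 : -inner ℝ (∑ n ∈ Finset.range T,
      (1 - P.xi i (n + 2)) • runNoise P K ε l d u z₀ n i) x ≤
      W * ‖∑ n ∈ Finset.range T, (1 - P.xi i (n + 2)) • runNoise P K ε l d u z₀ n i‖ := by
    have h4 := abs_le.1 (abs_real_inner_le_norm (∑ n ∈ Finset.range T,
      (1 - P.xi i (n + 2)) • runNoise P K ε l d u z₀ n i) x)
    have h5 := hW.norm_le' hP hx
    nlinarith [h4.1, norm_nonneg (∑ n ∈ Finset.range T,
      (1 - P.xi i (n + 2)) • runNoise P K ε l d u z₀ n i)]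
  have h4 := mul_le_mul_of_nonneg_left (sum_rpow_neg_quarter_le T)
    (by positivity : 0 ≤ 3 * P.L * P.delta i 1 + P.L * P.xi i 1 * W)
  refine hsum.trans ((add_le_add (mul_le_mul_of_nonneg_left
    (c := (2 + (2 * gradBound P W i * W) ^ 2 + descentConst P W i 0) * (T : ℝ) ^ (3 / 4 : ℝ) +
      (∑ n ∈ Finset.range T,
          inner ℝ (runNoise P K ε l d u z₀ n i) ((run P K ε l d u z₀ n).center i) +
        W * ‖∑ n ∈ Finset.range T, (1 - P.xi i (n + 2)) • runNoise P K ε l d u z₀ n i‖)) ?_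
    (by positivity : 0 ≤ ((closedNbhd G i).card : ℝ) / Fintype.card V)) h4).trans_eq ?_)
  · linarith
  · rw [pathConst]
    ring

end Pathwise

end

/-! ### Independence, and redrawing a single direction. -/

section

/-- Both hypotheses together say that the joint law is a triple product; reassociating it regroups
the factors. -/
theorem indepFun_prodMk_left_of_right {Ω A B C : Type*} [MeasurableSpace Ω] [MeasurableSpace A]
    [MeasurableSpace B] [MeasurableSpace C] {μ : Measure Ω} [IsProbabilityMeasure μ]
    {X : Ω → A} {Y : Ω → B} {Z : Ω → C} (hX : Measurable X) (hY : Measurable Y)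
    (hZ : Measurable Z) (h : IndepFun X (fun ω => (Y ω, Z ω)) μ) (hYZ : IndepFun Y Z μ) :
    IndepFun (fun ω => (X ω, Y ω)) Z μ := by
  have hXY : IndepFun X Y μ := h.comp measurable_id measurable_fst
  have := Measure.isProbabilityMeasure_map (μ := μ) hX.aemeasurable
  have := Measure.isProbabilityMeasure_map (μ := μ) hY.aemeasurable
  have := Measure.isProbabilityMeasure_map (μ := μ) hZ.aemeasurable
  rw [indepFun_iff_map_prod_eq_prod_map_map (hX.prodMk hY).aemeasurable hZ.aemeasurable,
    hXY.map_prod_eq_prod_map_map hX.aemeasurable hY.aemeasurable]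
  have h1 := h.map_prod_eq_prod_map_map hX.aemeasurable (hY.prodMk hZ).aemeasurable
  rw [hYZ.map_prod_eq_prod_map_map hY.aemeasurable hZ.aemeasurable,
    ← Measure.prodAssoc_prod] at h1
  have h2 := congrArg (Measure.map MeasurableEquiv.prodAssoc.symm) h1
  rw [Measure.map_map MeasurableEquiv.prodAssoc.symm.measurable
      (hX.prodMk (hY.prodMk hZ)),
    Measure.map_map MeasurableEquiv.prodAssoc.symm.measurable
      MeasurableEquiv.prodAssoc.measurable, MeasurableEquiv.symm_comp_self, Measure.map_id] at h2
  exact h2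

/-- Minimum over a compact space of a Carathéodory function. -/
theorem measurable_iInf_of_continuous {α Y : Type*} [MeasurableSpace α] [TopologicalSpace Y]
    [CompactSpace Y] [TopologicalSpace.SeparableSpace Y] [Nonempty Y] {h : α → Y → ℝ}
    (hm : ∀ y, Measurable fun a => h a y) (hc : ∀ a, Continuous (h a)) :
    Measurable fun a => ⨅ y, h a y := by
  refine measurable_of_Iio fun c => ?_
  have : (fun a => ⨅ y, h a y) ⁻¹' Set.Iio c =
      ⋃ n, {a | h a (TopologicalSpace.denseSeq Y n) < c} := by
    ext a
    have hb : BddBelow (Set.range (h a)) := (isCompact_range (hc a)).bddBelow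
    simp only [Set.mem_preimage, Set.mem_Iio, Set.mem_iUnion, Set.mem_ofPred_eq]
    rw [ciInf_lt_iff hb]
    constructor
    · rintro ⟨y, hy⟩
      obtain ⟨_, hz, n, rfl⟩ := (TopologicalSpace.denseRange_denseSeq Y).inter_open_nonempty
        {y | h a y < c} (isOpen_lt (hc a) continuous_const) ⟨y, hy⟩
      exact ⟨n, hz⟩
    · rintro ⟨n, hn⟩
      exact ⟨_, hn⟩
  rw [this]
  exact MeasurableSet.iUnion fun n => measurableSet_lt (hm _) measurable_const

variable {V : Type*} [Fintype V] [DecidableEq V] {G : SimpleGraph V} [DecidableRel G.Adj]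

variable (G) in
/-- Realisations of all exploration directions. -/
abbrev Directions : Type _ := ℕ → ∀ i, Metric.sphere (0 : Action G i) 1

variable (G) in
/-- Realisations of all random inputs: generations and initial points, and directions. -/
abbrev Input : Type _ := ((ℕ → V → ℝ) × (∀ i, Action G i)) × Directions G

/-- Replace the direction of node `i` in round `t`. -/
def resample (u : Directions G) (t : ℕ) (i : V) (v : Metric.sphere (0 : Action G i) 1) :
    Directions G :=
  Function.update u t (Function.update (u t) i v)

theorem resample_self (u : Directions G) (t : ℕ) (i : V) (v : Metric.sphere (0 : Action G i) 1) :
    resample u t i v t = Function.update (u t) i v := Function.update_self _ _ _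

theorem resample_of_ne (u : Directions G) {s t : ℕ} (h : s ≠ t) (i : V)
    (v : Metric.sphere (0 : Action G i) 1) : resample u t i v s = u s :=
  Function.update_of_ne h _ _

theorem resample_eq_self (u : Directions G) (t : ℕ) (i : V) : resample u t i (u t i) = u := by
  simp [resample]

theorem resample_resample (u : Directions G) (t : ℕ) (i : V)
    (v w : Metric.sphere (0 : Action G i) 1) :
    resample (resample u t i v) t i w = resample u t i w := by
  simp [resample]

theorem measurable_resample (t : ℕ) (i : V) :
    Measurable fun p : Directions G × Metric.sphere (0 : Action G i) 1 =>
      resample p.1 t i p.2 := by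
  refine measurable_pi_iff.2 fun s => measurable_pi_iff.2 fun k => ?_
  by_cases hs : s = t
  · subst hs
    simp only [resample_self]
    by_cases hk : k = i
    · subst hk
      simpa using measurable_snd
    · simp only [Function.update_of_ne hk]
      fun_prop
  · simp only [resample_of_ne _ hs]
    fun_prop

namespace Environment

variable {Ω : Type*} [MeasurableSpace Ω] {μ : Measure Ω} {P : Params G} {ℰ : Environment G Ω}

/-- The random input. -/
def input (ℰ : Environment G Ω) (ω : Ω) : Input G :=
  ((fun t i => ℰ.d t i ω, fun i => ℰ.z₀ i ω), fun t i => ℰ.u t i ω)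

theorem Valid.measurable_input (h : ℰ.Valid P μ) : Measurable ℰ.input := by
  refine (Measurable.prodMk ?_ ?_).prodMk ?_
  · exact measurable_pi_iff.2 fun t => measurable_pi_iff.2 fun i => h.measurable_d t i
  · exact measurable_pi_iff.2 fun i => h.measurable_z₀ i
  · exact measurable_pi_iff.2 fun t => measurable_pi_iff.2 fun i => h.measurable_u t i

variable [IsProbabilityMeasure μ]

/-- Once the direction of node `i` in round `t` is overwritten by a constant, what remains is a
function of the other directions and the environment, all independent of it. -/
theorem Valid.indepFun_resample (h : ℰ.Valid P μ) (t : ℕ) (i : V)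
    (v : Metric.sphere (0 : Action G i) 1) :
    IndepFun (fun ω => ((ℰ.input ω).1, resample (ℰ.input ω).2 t i v)) (ℰ.u t i) μ := by
  have hX := h.measurable_input
  have hr : Measurable fun u : Directions G => resample u t i v :=
    (measurable_resample t i).comp (measurable_id.prodMk measurable_const)
  refine indepFun_prodMk_left_of_right hX.fst (hr.comp hX.snd) (h.measurable_u t i) ?_ ?_
  · exact h.indep_env.comp measurable_id
      (hr.prodMk ((measurable_pi_apply i).comp (measurable_pi_apply t)))
  -- The overwritten family is measurable for the σ-algebra generated by all other directions, which
  -- is independent of the one generated by this direction.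
  · have hind := indep_iSup_of_disjoint
      (m := fun p : ℕ × V => MeasurableSpace.comap (ℰ.u p.1 p.2) inferInstance)
      (fun p => (h.measurable_u p.1 p.2).comap_le) h.indep_u
      (S := {p | p ≠ (t, i)}) (T := {(t, i)}) (by simp)
    refine indep_of_indep_of_le_left (indep_of_indep_of_le_right hind ?_) ?_
    · exact le_iSup₂_of_le (f := fun (p : ℕ × V) (_ : p ∈ ({(t, i)} : Set (ℕ × V))) =>
        MeasurableSpace.comap (ℰ.u p.1 p.2) inferInstance) (t, i) rfl le_rfl
    · rw [← measurable_iff_comap_le]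
      have hmeas : ∀ p : ℕ × V, p ≠ (t, i) →
          Measurable[⨆ p ∈ {p : ℕ × V | p ≠ (t, i)},
            MeasurableSpace.comap (ℰ.u p.1 p.2) inferInstance] (ℰ.u p.1 p.2) := fun p hp => by
        rw [measurable_iff_comap_le]
        exact le_iSup₂_of_le (f := fun (p : ℕ × V) (_ : p ∈ {p : ℕ × V | p ≠ (t, i)}) =>
          MeasurableSpace.comap (ℰ.u p.1 p.2) inferInstance) p hp le_rfl
      refine @measurable_pi_lambda _ _ _ (_) _ _ fun s => @measurable_pi_lambda _ _ _ (_) _ _ fun k => ?_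
      by_cases hs : s = t
      · subst hs
        simp only [resample_self]
        by_cases hk : k = i
        · subst hk
          simp only [Function.update_self]
          exact measurable_const
        · simp only [Function.update_of_ne hk]
          exact hmeas (s, k) (by simp [hk])
      · simp only [resample_of_ne _ hs]
        exact hmeas (s, k) (by simp [hs])

/-- Resampling one direction does not change the law of the input. -/
theorem Valid.map_resample (h : ℰ.Valid P μ) (hP : P.Valid) (t : ℕ) (i : V) :
    (μ.prod (uniformSphere (Action G i))).map
      (fun p => ((ℰ.input p.1).1, resample (ℰ.input p.1).2 t i p.2)) = μ.map ℰ.input := by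
  have := hP.nontrivial_action i
  have hX := h.measurable_input
  obtain ⟨ω₀⟩ : Nonempty Ω := nonempty_of_isProbabilityMeasure μ
  set v₀ := ℰ.u t i ω₀
  set X' : Ω → Input G := fun ω => ((ℰ.input ω).1, resample (ℰ.input ω).2 t i v₀)
  have hX' : Measurable X' :=
    hX.fst.prodMk ((measurable_resample t i).comp (hX.snd.prodMk measurable_const))
  set Φ : Input G × Metric.sphere (0 : Action G i) 1 → Input G :=
    fun q => (q.1.1, resample q.1.2 t i q.2)
  have hΦ : Measurable Φ := measurable_fst.fst.prodMk
    ((measurable_resample t i).comp (measurable_fst.snd.prodMk measurable_snd))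
  have hind := (h.indepFun_resample t i v₀).map_prod_eq_prod_map_map hX'.aemeasurable
    (h.measurable_u t i).aemeasurable
  rw [h.uniform_u] at hind
  -- The input is recovered by reinserting the true direction into the overwritten input. A fresh
  -- direction inserted by the same map gives the same law, since the pair has a product law.
  have e1 : ℰ.input = Φ ∘ fun ω => (X' ω, ℰ.u t i ω) := by
    ext1 ω
    simp only [Φ, X', Function.comp, resample_resample]
    exact Prod.ext rfl (resample_eq_self _ _ _).symm
  have e2 : (fun p : Ω × Metric.sphere (0 : Action G i) 1 =>
      (((ℰ.input p.1).1, resample (ℰ.input p.1).2 t i p.2) : Input G)) =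
      Φ ∘ Prod.map X' id := by
    ext1 p
    simp only [Φ, X', Function.comp, Prod.map, resample_resample, id]
  rw [e2, ← Measure.map_map hΦ (hX'.prodMap measurable_id),
    ← Measure.map_prod_map _ _ hX' measurable_id, Measure.map_id, ← hind,
    Measure.map_map hΦ (hX'.prodMk (h.measurable_u t i)), ← e1]

/-- The tower property with respect to everything except one direction, in the form of Fubini. -/
theorem Valid.integral_resample (h : ℰ.Valid P μ) (hP : P.Valid) (t : ℕ) (i : V)
    {H : Input G → ℝ} (hH : Measurable H) (hint : Integrable (fun ω => H (ℰ.input ω)) μ) :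
    ∫ ω, H (ℰ.input ω) ∂μ =
      ∫ ω, ∫ v, H ((ℰ.input ω).1, resample (ℰ.input ω).2 t i v) ∂uniformSphere (Action G i) ∂μ := by
  have := hP.nontrivial_action i
  have hX := h.measurable_input
  have hΨ : Measurable fun p : Ω × Metric.sphere (0 : Action G i) 1 =>
      (((ℰ.input p.1).1, resample (ℰ.input p.1).2 t i p.2) : Input G) :=
    (hX.fst.comp measurable_fst).prodMk ((measurable_resample t i).comp
      ((hX.snd.comp measurable_fst).prodMk measurable_snd))
  have hmap := h.map_resample hP t i
  have hint' : Integrable H (μ.map ℰ.input) :=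
    (integrable_map_measure hH.aestronglyMeasurable hX.aemeasurable).2 hint
  have h1 : ∫ ω, H (ℰ.input ω) ∂μ = ∫ a, H a ∂(μ.map ℰ.input) :=
    (integral_map hX.aemeasurable hH.aestronglyMeasurable).symm
  rw [← hmap] at h1 hint'
  rw [h1, integral_map hΨ.aemeasurable hH.aestronglyMeasurable, integral_prod]
  exact (integrable_map_measure hH.aestronglyMeasurable hΨ.aemeasurable).1 hint'

end Environment

end

/-! ### The estimation noise as a function of the input, and its moments. -/

section

variable {V : Type*} [Fintype V] [DecidableEq V] {G : SimpleGraph V} [DecidableRel G.Adj]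

section InputFunctions

variable (P : Params G) (K : ℕ) (ε : ℝ) (l : ℕ → V → ℝ)

/-- Directions as vectors. -/
def directionVec (u : Directions G) (t : ℕ) (i : V) : Action G i := u t i

/-- State after `n` rounds as a function of the input. -/
noncomputable def inputState (n : ℕ) (a : Input G) : State G K :=
  run P K ε l a.1.1 (directionVec a.2) a.1.2 n

/-- `runGrad` as a function of the input. -/
noncomputable def inputGrad (n : ℕ) (i : V) (a : Input G) : Action G i :=
  runGrad P K ε l a.1.1 (directionVec a.2) a.1.2 n i

/-- `runMean` as a function of the input. -/
noncomputable def inputMean (n : ℕ) (i : V) (a : Input G) : Action G i :=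
  runMean P K ε l a.1.1 (directionVec a.2) a.1.2 n i

/-- `runNoise` as a function of the input. -/
noncomputable def inputNoise (n : ℕ) (i : V) (a : Input G) : Action G i :=
  runNoise P K ε l a.1.1 (directionVec a.2) a.1.2 n i

/-- `runLoss` as a function of the input. -/
noncomputable def inputLoss (n : ℕ) (i : V) (a : Input G) (y : Action G i) : ℝ :=
  runLoss P K ε l a.1.1 (directionVec a.2) a.1.2 n i y

/-- `runQuery` as a function of the input. -/
noncomputable def inputQuery (n : ℕ) (i : V) (a : Input G) : Action G i :=
  runQuery P K ε l a.1.1 (directionVec a.2) a.1.2 n i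

/-- `GoodInput` as a property of the input. -/
def IsGood (a : Input G) : Prop := GoodInput P l a.1.1 (directionVec a.2) a.1.2

variable {P K ε l}

theorem measurable_directionVec (t : ℕ) (i : V) :
    Measurable fun a : Input G => directionVec a.2 t i := by
  unfold directionVec
  fun_prop

theorem measurable_inputState (hP : P.Valid) (n : ℕ) :
    State.Meas (inputState P K ε l n) :=
  measurable_run hP K ε l (d := fun t i (a : Input G) => a.1.1 t i)
    (u := fun t i (a : Input G) => directionVec a.2 t i)
    (z₀ := fun i (a : Input G) => a.1.2 i) (fun t i => by fun_prop) (fun t i => measurable_directionVec t i)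
    (fun i => by fun_prop) n

theorem measurable_inputGrad (hP : P.Valid) (n : ℕ) (i : V) :
    Measurable (inputGrad P K ε l n i) :=
  (measurable_inputState (K := K) (ε := ε) (l := l) hP n).gradLoss (P := P) (t := n + 1)
    (l := l (n + 1)) (d := fun i (a : Input G) => a.1.1 (n + 1) i)
    (u := fun i (a : Input G) => directionVec a.2 (n + 1) i) (fun i => by fun_prop)
    (fun i => measurable_directionVec _ i) i

theorem measurable_inputQuery (hP : P.Valid) (n : ℕ) (i : V) :
    Measurable (inputQuery P K ε l n i) :=
  (measurable_inputState (K := K) (ε := ε) (l := l) hP n).query (P := P) (t := n + 1)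
    (u := fun i (a : Input G) => directionVec a.2 (n + 1) i)
    (fun i => measurable_directionVec _ i) i

theorem measurable_inputLoss (hP : P.Valid) (n : ℕ) (i : V) {y : Input G → Action G i}
    (hy : Measurable y) : Measurable fun a => inputLoss P K ε l n i a (y a) :=
  (measurable_inputState (K := K) (ε := ε) (l := l) hP n).ownLoss (P := P) (t := n + 1)
    (l := l (n + 1)) (d := fun i (a : Input G) => a.1.1 (n + 1) i)
    (u := fun i (a : Input G) => directionVec a.2 (n + 1) i) (fun i => by fun_prop)
    (fun i => measurable_directionVec _ i) i hy

theorem IsGood.resample {a : Input G} (h : IsGood P l a) (t : ℕ) (i : V)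
    (v : Metric.sphere (0 : Action G i) 1) : IsGood P l (a.1, resample a.2 t i v) where
  demand := h.demand
  generation := h.generation
  norm_u s k := by simp [directionVec]
  start := h.start

/-- Causality: the state after `m` rounds uses only directions of rounds up to `m`. -/
theorem inputState_resample {m t : ℕ} (hmt : m < t) (i : V) (a : Input G)
    (v : Metric.sphere (0 : Action G i) 1) :
    inputState P K ε l m (a.1, resample a.2 t i v) = inputState P K ε l m a := by
  induction m with
  | zero => rfl
  | succ m ih =>
    have ih := ih (by omega)
    unfold inputState at ih ⊢
    rw [run, ih, run]
    have : directionVec (EnergySharing.resample a.2 t i v) (m + 1) =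
        directionVec a.2 (m + 1) := by
      unfold directionVec
      rw [resample_of_ne _ hmt.ne]
    dsimp only
    rw [this]

theorem directionVec_resample (u : Directions G) (t : ℕ) (i : V)
    (v : Metric.sphere (0 : Action G i) 1) :
    directionVec (resample u t i v) t = Function.update (directionVec u t) i (v : Action G i) := by
  ext1 k
  unfold directionVec
  rw [resample_self]
  by_cases h : k = i
  · subst h; simp
  · simp [h]

theorem inputGrad_resample (n : ℕ) (i : V) (a : Input G)
    (v : Metric.sphere (0 : Action G i) 1) :
    inputGrad P K ε l n i (a.1, resample a.2 (n + 1) i v) =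
      ((Fintype.card V : ℝ) / P.delta i (n + 1) * inputLoss P K ε l n i a
        ((inputState P K ε l n a).center i + P.delta i (n + 1) • (v : Action G i))) •
        (v : Action G i) := by
  have h := inputState_resample (P := P) (K := K) (ε := ε) (l := l) (Nat.lt_succ_self n) i a v
  unfold inputState at h
  rw [inputGrad, runGrad, State.gradLoss]
  dsimp only
  rw [h, directionVec_resample, State.ownLoss_update, State.query, Function.update_self]
  rfl

/-- Redrawing the direction of node `i` changes neither the state nor the loss function of that
round, so the conditional mean is the average of the estimate over the redrawn direction. -/
theorem inputMean_eq (n : ℕ) (i : V) (a : Input G) :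
    inputMean P K ε l n i a =
      ∫ v, inputGrad P K ε l n i (a.1, resample a.2 (n + 1) i v)
        ∂uniformSphere (Action G i) := by
  simp only [inputGrad_resample]
  rfl

theorem inputNoise_resample {m n : ℕ} (hmn : m < n) (i : V) (a : Input G)
    (v : Metric.sphere (0 : Action G i) 1) :
    inputNoise P K ε l m i (a.1, resample a.2 (n + 1) i v) = inputNoise P K ε l m i a := by
  have h := inputState_resample (P := P) (K := K) (ε := ε) (l := l)
    (by omega : m < n + 1) i a v
  unfold inputState at h
  have hd : directionVec (resample a.2 (n + 1) i v) (m + 1) = directionVec a.2 (m + 1) := by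
    unfold directionVec
    rw [resample_of_ne _ (by omega)]
  unfold inputNoise runNoise runMean runGrad
  dsimp only
  rw [h, hd]

theorem measurable_inputMean (hP : P.Valid) (n : ℕ) (i : V) :
    Measurable (inputMean P K ε l n i) := by
  have := hP.nontrivial_action i
  have h : StronglyMeasurable fun q : Input G × Metric.sphere (0 : Action G i) 1 =>
      inputGrad P K ε l n i (q.1.1, resample q.1.2 (n + 1) i q.2) :=
    ((measurable_inputGrad hP n i).comp (measurable_fst.fst.prodMk
      ((measurable_resample (n + 1) i).comp
        (measurable_fst.snd.prodMk measurable_snd)))).stronglyMeasurable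
  have h2 := h.integral_prod_right' (ν := uniformSphere (Action G i))
  simp only [← inputMean_eq] at h2
  exact h2.measurable

theorem measurable_inputNoise (hP : P.Valid) (n : ℕ) (i : V) :
    Measurable (inputNoise P K ε l n i) :=
  (measurable_inputMean hP n i).sub (measurable_inputGrad hP n i)

variable {W : ℝ}

theorem norm_inputGrad_le (hP : P.Valid) (hW : IsRadius P W) (hK : 0 < K) {a : Input G}
    (h : IsGood P l a) (i : V) {n T : ℕ} (hn : n < T) :
    ‖inputGrad P K ε l n i a‖ ≤ gradBound P W i * (T : ℝ) ^ (1 / 4 : ℝ) :=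
  norm_runGrad_le hP hW hK h i hn

theorem norm_inputMean_le (hP : P.Valid) (hW : IsRadius P W) (hK : 0 < K) {a : Input G}
    (h : IsGood P l a) (i : V) {n T : ℕ} (hn : n < T) :
    ‖inputMean P K ε l n i a‖ ≤ gradBound P W i * (T : ℝ) ^ (1 / 4 : ℝ) := by
  have := hP.nontrivial_action i
  rw [inputMean_eq]
  refine (norm_integral_le_of_norm_le_const (ae_of_all _ fun v =>
    norm_inputGrad_le hP hW hK (h.resample (n + 1) i v) i hn)).trans_eq ?_
  simp

theorem norm_inputNoise_le (hP : P.Valid) (hW : IsRadius P W) (hK : 0 < K) {a : Input G}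
    (h : IsGood P l a) (i : V) {n T : ℕ} (hn : n < T) :
    ‖inputNoise P K ε l n i a‖ ≤ 2 * (gradBound P W i * (T : ℝ) ^ (1 / 4 : ℝ)) := by
  refine (norm_sub_le _ _).trans ?_
  have h1 := norm_inputGrad_le (ε := ε) hP hW hK h i hn
  have h2 := norm_inputMean_le (ε := ε) hP hW hK h i hn
  unfold inputGrad at h1
  unfold inputMean at h2
  linarith

end InputFunctions

namespace Environment

variable {Ω : Type*} [MeasurableSpace Ω] {μ : Measure Ω} {P : Params G} {ℰ : Environment G Ω}
  {K : ℕ} {ε W : ℝ}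

theorem Valid.ae_isGood (h : ℰ.Valid P μ) : ∀ᵐ ω ∂μ, IsGood P ℰ.l (ℰ.input ω) := by
  have h1 : ∀ᵐ ω ∂μ, ∀ t i, 0 ≤ ℰ.d t i ω := by
    simp only [ae_all_iff]
    exact h.generation
  have h2 : ∀ᵐ ω ∂μ, ∀ i, ℰ.z₀ i ω ∈ (1 - P.xi i 1) • P.X i := ae_all_iff.2 h.start
  filter_upwards [h1, h2] with ω hd hz
  exact ⟨h.demand, hd, fun t i => by simp [directionVec], hz⟩

variable [IsProbabilityMeasure μ]

theorem Valid.integrable_input (h : ℰ.Valid P μ) {H : Input G → ℝ} (hH : Measurable H) {C : ℝ}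
    (hC : ∀ a, IsGood P ℰ.l a → |H a| ≤ C) : Integrable (fun ω => H (ℰ.input ω)) μ := by
  refine Integrable.of_bound (hH.comp h.measurable_input).aestronglyMeasurable C ?_
  filter_upwards [h.ae_isGood] with ω hω
  exact hC _ hω

/-- The errors of the gradient estimates are orthogonal to what does not depend on the direction
of the round. -/
theorem Valid.integral_inner_inputNoise (h : ℰ.Valid P μ) (hP : P.Valid) (hW : IsRadius P W)
    (hK : 0 < K) (n : ℕ) (i : V) {Y : Input G → Action G i} (hY : Measurable Y) {C : ℝ}
    (hC : ∀ a, IsGood P ℰ.l a → ‖Y a‖ ≤ C)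
    (hinv : ∀ a v, Y (a.1, resample a.2 (n + 1) i v) = Y a) :
    ∫ ω, inner ℝ (inputNoise P K ε ℰ.l n i (ℰ.input ω)) (Y (ℰ.input ω)) ∂μ = 0 := by
  have := hP.nontrivial_action i
  set B := gradBound P W i * ((n + 1 : ℕ) : ℝ) ^ (1 / 4 : ℝ)
  have hB : 0 ≤ B := mul_nonneg (gradBound_nonneg hP hW i) (by positivity)
  have hmG := measurable_inputGrad (K := K) (ε := ε) (l := ℰ.l) hP n i
  have hmM := measurable_inputMean (K := K) (ε := ε) (l := ℰ.l) hP n i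
  have hbd : ∀ {a} {x : Action G i}, IsGood P ℰ.l a → ‖x‖ ≤ B → |inner ℝ x (Y a)| ≤ B * C :=
    fun ha hx => (abs_real_inner_le_norm _ _).trans
      (mul_le_mul hx (hC _ ha) (norm_nonneg _) hB)
  have hi1 := h.integrable_input (hmG.inner hY) fun a ha =>
    hbd ha (norm_inputGrad_le (ε := ε) hP hW hK ha i (Nat.lt_succ_self n))
  have hi2 := h.integrable_input (hmM.inner hY) fun a ha =>
    hbd ha (norm_inputMean_le (ε := ε) hP hW hK ha i (Nat.lt_succ_self n))
  have e : ∫ ω, inner ℝ (inputGrad P K ε ℰ.l n i (ℰ.input ω)) (Y (ℰ.input ω)) ∂μ =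
      ∫ ω, inner ℝ (inputMean P K ε ℰ.l n i (ℰ.input ω)) (Y (ℰ.input ω)) ∂μ := by
    -- `Y` is unaffected by the redraw, so the inner integral sees only the estimate and turns it
    -- into its mean.
    rw [h.integral_resample hP (n + 1) i (hmG.inner hY) hi1]
    refine integral_congr_ae ?_
    filter_upwards [h.ae_isGood] with ω hω
    simp only [hinv]
    have hint : Integrable (fun v => inputGrad P K ε ℰ.l n i
        ((ℰ.input ω).1, resample (ℰ.input ω).2 (n + 1) i v)) (uniformSphere (Action G i)) :=
      Integrable.of_bound (hmG.comp (measurable_const.prodMk ((measurable_resample (n + 1) i).comp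
        (measurable_const.prodMk measurable_id)))).aestronglyMeasurable B
        (ae_of_all _ fun v => norm_inputGrad_le hP hW hK (hω.resample (n + 1) i v) i
          (Nat.lt_succ_self n))
    rw [inputMean_eq, real_inner_comm, ← integral_inner hint]
    exact integral_congr_ae (ae_of_all _ fun v => real_inner_comm _ _)
  have hsub : ∀ ω, inner ℝ (inputNoise P K ε ℰ.l n i (ℰ.input ω)) (Y (ℰ.input ω)) =
      inner ℝ (inputMean P K ε ℰ.l n i (ℰ.input ω)) (Y (ℰ.input ω)) -
        inner ℝ (inputGrad P K ε ℰ.l n i (ℰ.input ω)) (Y (ℰ.input ω)) := fun ω => by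
    rw [← inner_sub_left]; rfl
  simp only [hsub]
  rw [integral_sub hi2 hi1, e, sub_self]

theorem Valid.integral_inner_inputNoise_center (h : ℰ.Valid P μ) (hP : P.Valid)
    (hW : IsRadius P W) (hK : 0 < K) (n : ℕ) (i : V) :
    ∫ ω, inner ℝ (inputNoise P K ε ℰ.l n i (ℰ.input ω))
      ((inputState P K ε ℰ.l n (ℰ.input ω)).center i) ∂μ = 0 :=
  h.integral_inner_inputNoise hP hW hK n i
    (Y := fun a => (inputState P K ε ℰ.l n a).center i)
    ((measurable_inputState hP n).center i) (C := W)
    (fun _ ha => norm_run_center_le hP hW hK ha i n)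
    (fun a v => by rw [inputState_resample (Nat.lt_succ_self n)])

end Environment

section NoiseSum

variable (P : Params G) (K : ℕ) (ε : ℝ) (l : ℕ → V → ℝ)

/-- Weighted sum of the errors of the gradient estimates of the first `m` rounds. -/
noncomputable def noiseSum (m : ℕ) (i : V) (a : Input G) : Action G i :=
  ∑ n ∈ Finset.range m, (1 - P.xi i (n + 2)) • inputNoise P K ε l n i a

/-- Scale of the weighted sum of the errors. -/
noncomputable def noiseConst (W : ℝ) (i : V) : ℝ :=
  (1 + P.xi i 1) * (2 * gradBound P W i) + 1

variable {P K ε l} {W : ℝ}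

theorem noiseConst_pos (hP : P.Valid) (hW : IsRadius P W) (i : V) : 0 < noiseConst P W i := by
  have := gradBound_nonneg hP hW i
  have := hP.xi_pos i le_rfl
  unfold noiseConst
  positivity

theorem measurable_noiseSum (hP : P.Valid) (m : ℕ) (i : V) :
    Measurable (noiseSum P K ε l m i) :=
  Finset.measurable_fun_sum _ fun n _ =>
    (measurable_inputNoise hP n i).fun_const_smul (1 - P.xi i (n + 2))

theorem norm_smul_inputNoise_le (hP : P.Valid) (hW : IsRadius P W) (hK : 0 < K) {a : Input G}
    (h : IsGood P l a) (i : V) {n T : ℕ} (hn : n < T) :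
    ‖(1 - P.xi i (n + 2)) • inputNoise P K ε l n i a‖ ≤
      noiseConst P W i * (T : ℝ) ^ (1 / 4 : ℝ) := by
  have h1 := norm_inputNoise_le (ε := ε) hP hW hK h i hn
  have h2 := hP.abs_one_sub_xi_le i (Nat.le_add_left 1 (n + 1))
  have h3 := hP.xi_pos i le_rfl
  have h4 : 0 ≤ (T : ℝ) ^ (1 / 4 : ℝ) := by positivity
  rw [norm_smul, Real.norm_eq_abs]
  refine (mul_le_mul h2 h1 (norm_nonneg _) (by linarith)).trans ?_
  rw [noiseConst]
  linarith

theorem norm_noiseSum_le (hP : P.Valid) (hW : IsRadius P W) (hK : 0 < K) {a : Input G}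
    (h : IsGood P l a) (i : V) {m T : ℕ} (hm : m ≤ T) :
    ‖noiseSum P K ε l m i a‖ ≤ m * (noiseConst P W i * (T : ℝ) ^ (1 / 4 : ℝ)) := by
  refine (norm_sum_le_of_le _ fun n hn => norm_smul_inputNoise_le hP hW hK h i
    ((Finset.mem_range.1 hn).trans_le hm)).trans_eq ?_
  simp

variable {Ω : Type*} [MeasurableSpace Ω] {μ : Measure Ω} [IsProbabilityMeasure μ]
  {ℰ : Environment G Ω}

/-- Martingale orthogonality: earlier noise does not depend on the current direction, so cross terms
integrate to zero and the second moment grows linearly in the number of rounds. -/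
theorem integral_norm_noiseSum_sq_le (h : ℰ.Valid P μ) (hP : P.Valid) (hW : IsRadius P W)
    (hK : 0 < K) (i : V) {m T : ℕ} (hm : m ≤ T) :
    ∫ ω, ‖noiseSum P K ε ℰ.l m i (ℰ.input ω)‖ ^ 2 ∂μ ≤
      m * (noiseConst P W i * (T : ℝ) ^ (1 / 4 : ℝ)) ^ 2 := by
  set B := noiseConst P W i * (T : ℝ) ^ (1 / 4 : ℝ)
  have hB : 0 ≤ B := mul_nonneg (noiseConst_pos hP hW i).le (by positivity)
  induction m with
  | zero => simp [noiseSum]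
  | succ m ih =>
    have ih := ih (by omega)
    set X : Input G → Action G i := fun a =>
      (1 - P.xi i (m + 2)) • inputNoise P K ε ℰ.l m i a
    have hX : Measurable X := (measurable_inputNoise hP m i).fun_const_smul _
    have hS : Measurable (noiseSum P K ε ℰ.l m i) := measurable_noiseSum hP m i
    have hXb : ∀ a, IsGood P ℰ.l a → ‖X a‖ ≤ B := fun a ha =>
      norm_smul_inputNoise_le hP hW hK ha i hm
    have hSb : ∀ a, IsGood P ℰ.l a → ‖noiseSum P K ε ℰ.l m i a‖ ≤ m * B := fun a ha =>
      norm_noiseSum_le hP hW hK ha i (by omega)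
    have e : ∀ a, ‖noiseSum P K ε ℰ.l (m + 1) i a‖ ^ 2 =
        ‖noiseSum P K ε ℰ.l m i a‖ ^ 2 + 2 * inner ℝ (X a) (noiseSum P K ε ℰ.l m i a) +
          ‖X a‖ ^ 2 := fun a => by
      rw [noiseSum, Finset.sum_range_succ, norm_add_sq_real, real_inner_comm]; rfl
    have h0 : ∫ ω, inner ℝ (X (ℰ.input ω)) (noiseSum P K ε ℰ.l m i (ℰ.input ω)) ∂μ = 0 := by
      have := h.integral_inner_inputNoise (ε := ε) hP hW hK m i hS hSb (fun a v => by
        refine Finset.sum_congr rfl fun n hn => ?_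
        rw [inputNoise_resample (Finset.mem_range.1 hn)])
      simp only [X, real_inner_smul_left]
      rw [integral_const_mul, this, mul_zero]
    have i1 := h.integrable_input (hS.norm.pow_const 2) (C := (m * B) ^ 2) fun a ha => by
      rw [abs_of_nonneg (by positivity)]
      exact pow_le_pow_left₀ (norm_nonneg _) (hSb a ha) 2
    have i2 := h.integrable_input ((hX.inner hS).const_mul 2) (C := 2 * (B * (m * B)))
      fun a ha => by
        rw [abs_mul, abs_of_pos two_pos]
        gcongr
        exact (abs_real_inner_le_norm _ _).trans
          (mul_le_mul (hXb a ha) (hSb a ha) (norm_nonneg _) hB)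
    have i3 := h.integrable_input (hX.norm.pow_const 2) (C := B ^ 2) fun a ha => by
      rw [abs_of_nonneg (by positivity)]
      exact pow_le_pow_left₀ (norm_nonneg _) (hXb a ha) 2
    have h3 : ∫ ω, ‖X (ℰ.input ω)‖ ^ 2 ∂μ ≤ B ^ 2 := by
      refine (integral_mono_ae i3 (integrable_const (B ^ 2)) ?_).trans_eq (by simp)
      filter_upwards [h.ae_isGood] with ω hω
      exact pow_le_pow_left₀ (norm_nonneg _) (hXb _ hω) 2
    simp only [e]
    have i12 : Integrable (fun ω => ‖noiseSum P K ε ℰ.l m i (ℰ.input ω)‖ ^ 2 +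
        2 * inner ℝ (X (ℰ.input ω)) (noiseSum P K ε ℰ.l m i (ℰ.input ω))) μ := i1.add i2
    rw [integral_add i12 i3, integral_add i1 i2, integral_const_mul, h0]
    push_cast
    linarith

theorem integral_norm_noiseSum_le (h : ℰ.Valid P μ) (hP : P.Valid) (hW : IsRadius P W)
    (hK : 0 < K) (i : V) {T : ℕ} (hT : 1 ≤ T) :
    ∫ ω, ‖noiseSum P K ε ℰ.l T i (ℰ.input ω)‖ ∂μ ≤
      noiseConst P W i * (T : ℝ) ^ (3 / 4 : ℝ) := by
  have hT0 : (0 : ℝ) < T := Nat.cast_pos.2 hT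
  have hc0 := noiseConst_pos hP hW i
  set c := noiseConst P W i * (T : ℝ) ^ (3 / 4 : ℝ) with hc
  have hcpos : 0 < c := by positivity
  have hsq := integral_norm_noiseSum_sq_le (ε := ε) h hP hW hK i (le_refl T)
  have e : T * (noiseConst P W i * (T : ℝ) ^ (1 / 4 : ℝ)) ^ 2 = c ^ 2 := by
    have e1 : (T : ℝ) * ((T : ℝ) ^ (1 / 4 : ℝ)) ^ 2 = ((T : ℝ) ^ (3 / 4 : ℝ)) ^ 2 := by
      rw [← Real.rpow_natCast, ← Real.rpow_natCast, ← Real.rpow_mul hT0.le,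
        ← Real.rpow_mul hT0.le]
      nth_rewrite 1 [← Real.rpow_one (T : ℝ)]
      rw [← Real.rpow_add hT0]
      norm_num
    rw [hc, mul_pow, mul_pow, ← e1]
    ring
  rw [e] at hsq
  have hS : Measurable (noiseSum P K ε ℰ.l T i) := measurable_noiseSum hP T i
  have hSb := fun a (ha : IsGood P ℰ.l a) =>
    norm_noiseSum_le (K := K) (ε := ε) hP hW hK ha i (le_refl T)
  have i1 := h.integrable_input hS.norm fun a ha => by
    rw [abs_norm]; exact hSb a ha
  have i2 := h.integrable_input (hS.norm.pow_const 2) fun a ha => by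
    rw [abs_of_nonneg (by positivity)]
    exact pow_le_pow_left₀ (norm_nonneg _) (hSb a ha) 2
  -- The elementary bound `s ≤ s ^ 2 / (2 * c) + c / 2`, with `c` the root of the second-moment
  -- bound, passes from the second to the first moment.
  have hle : ∫ ω, ‖noiseSum P K ε ℰ.l T i (ℰ.input ω)‖ ∂μ ≤
      ∫ ω, (‖noiseSum P K ε ℰ.l T i (ℰ.input ω)‖ ^ 2 / (2 * c) + c / 2) ∂μ := by
    refine integral_mono i1 ((i2.div_const _).add (integrable_const _)) fun ω => ?_
    have h1 := sq_nonneg (‖noiseSum P K ε ℰ.l T i (ℰ.input ω)‖ - c)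
    have h2 : ‖noiseSum P K ε ℰ.l T i (ℰ.input ω)‖ ^ 2 / (2 * c) + c / 2 =
        (‖noiseSum P K ε ℰ.l T i (ℰ.input ω)‖ ^ 2 + c ^ 2) / (2 * c) := by field_simp
    change _ ≤ ‖noiseSum P K ε ℰ.l T i (ℰ.input ω)‖ ^ 2 / (2 * c) + c / 2
    rw [h2, le_div_iff₀ (by positivity)]
    linarith
  rw [integral_add (i2.div_const _) (integrable_const _), integral_div, integral_const] at hle
  simp only [probReal_univ, smul_eq_mul, one_mul] at hle
  have h5 : (∫ ω, ‖noiseSum P K ε ℰ.l T i (ℰ.input ω)‖ ^ 2 ∂μ) / (2 * c) ≤ c ^ 2 / (2 * c) := by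
    gcongr
  have h6 : c ^ 2 / (2 * c) = c / 2 := by field_simp
  linarith

end NoiseSum

end

/-! ### Integrability and the expected regret. -/

section

namespace Environment

variable {V : Type*} [Fintype V] [DecidableEq V] {G : SimpleGraph V} [DecidableRel G.Adj]
  {Ω : Type*} [MeasurableSpace Ω] {μ : Measure Ω} {P : Params G} {ℰ : Environment G Ω}
  {ε W : ℝ}

theorem numExperts_pos (T : ℕ) : 0 < numExperts T := Nat.succ_pos _

theorem algLoss_eq {Ω : Type*} {ℰ : Environment G Ω} (ε : ℝ) (T : ℕ) (i : V) (ω : Ω) :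
    ℰ.algLoss P ε T i ω = ∑ n ∈ Finset.range T,
      inputLoss P (numExperts T) ε ℰ.l n i (ℰ.input ω)
        (inputQuery P (numExperts T) ε ℰ.l n i (ℰ.input ω)) := rfl

theorem minLoss_eq {Ω : Type*} {ℰ : Environment G Ω} (ε : ℝ) (T : ℕ) (i : V) (ω : Ω) :
    ℰ.minLoss P ε T i ω = ⨅ y : P.X i, ∑ n ∈ Finset.range T,
      inputLoss P (numExperts T) ε ℰ.l n i (ℰ.input ω) y := rfl

theorem abs_sum_inputLoss_le (hP : P.Valid) (hW : IsRadius P W) {l : ℕ → V → ℝ} {a : Input G}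
    (h : IsGood P l a) (T : ℕ) (i : V) {y : ℕ → Action G i} (hy : ∀ n, ‖y n‖ ≤ W) :
    |∑ n ∈ Finset.range T, inputLoss P (numExperts T) ε l n i a (y n)| ≤
      T * lossBound P W := by
  refine (Finset.abs_sum_le_sum_abs _ _).trans ((Finset.sum_le_sum fun n _ =>
    abs_run_ownLoss_le hP hW (numExperts_pos T) h i n (hy n)).trans_eq ?_)
  simp

variable [IsProbabilityMeasure μ]

theorem Valid.integrable_algLoss (h : ℰ.Valid P μ) (hP : P.Valid) (hW : IsRadius P W) (T : ℕ)
    (i : V) : Integrable (ℰ.algLoss P ε T i) μ := by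
  rw [funext (algLoss_eq ε T i)]
  exact h.integrable_input (H := fun a => ∑ n ∈ Finset.range T,
      inputLoss P (numExperts T) ε ℰ.l n i a (inputQuery P (numExperts T) ε ℰ.l n i a))
    (Finset.measurable_fun_sum _ fun n _ =>
      measurable_inputLoss hP n i (measurable_inputQuery hP n i))
    fun a ha => abs_sum_inputLoss_le hP hW ha T i fun n =>
      norm_run_query_le hP hW (numExperts_pos T) ha i n

theorem Valid.integrable_minLoss (h : ℰ.Valid P μ) (hP : P.Valid) (hW : IsRadius P W) (T : ℕ)
    (i : V) : Integrable (ℰ.minLoss P ε T i) μ := by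
  have : CompactSpace (P.X i) := isCompact_iff_compactSpace.1 (hP.isCompact i)
  have : Nonempty (P.X i) := (hP.nonempty i).to_subtype
  rw [funext (minLoss_eq ε T i)]
  refine h.integrable_input (H := fun a => ⨅ y : P.X i, ∑ n ∈ Finset.range T,
      inputLoss P (numExperts T) ε ℰ.l n i a y) (C := T * lossBound P W)
    (measurable_iInf_of_continuous (fun y => Finset.measurable_fun_sum _ fun n _ =>
      measurable_inputLoss hP n i measurable_const) fun a => ?_) fun a ha => ?_
  · refine continuous_finsetSum _ fun n _ => ?_
    have : Continuous (inputLoss P (numExperts T) ε ℰ.l n i a) :=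
      (LipschitzWith.of_dist_le_mul (K := ⟨P.L, hP.L_pos.le⟩) fun y y' => by
        rw [Real.dist_eq, dist_eq_norm]
        exact State.abs_ownLoss_sub_le _ _ _ _ hP (h.demand _) i y y').continuous
    exact this.comp continuous_subtype_val
  · have hb : ∀ y : P.X i, |∑ n ∈ Finset.range T,
        inputLoss P (numExperts T) ε ℰ.l n i a y| ≤ T * lossBound P W := fun y =>
      abs_sum_inputLoss_le hP hW ha T i fun _ => hW.norm_le' hP y.2
    refine abs_le.2 ⟨le_ciInf fun y => (abs_le.1 (hb y)).1, ?_⟩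
    obtain ⟨y⟩ := this
    exact (ciInf_le ⟨-(T * lossBound P W), by rintro _ ⟨y, rfl⟩; exact (abs_le.1 (hb y)).1⟩
      y).trans (abs_le.1 (hb y)).2

/-- The static regret is at most a constant multiple of `T ^ (3 / 4)`. -/
theorem Valid.staticRegret_le (h : ℰ.Valid P μ) (hP : P.Valid) (hW : IsRadius P W) {T : ℕ}
    (hT : 1 ≤ T) (hε : ε = ((T : ℝ) + 1) ^ (-(3 / 4) : ℝ)) (i : V) :
    ℰ.staticRegret P ε T i μ ≤
      (pathConst P W i + ((closedNbhd G i).card : ℝ) / Fintype.card V *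
        (W * noiseConst P W i)) * (T : ℝ) ^ (3 / 4 : ℝ) := by
  have hne : Nonempty (P.X i) := (hP.nonempty i).to_subtype
  have hK := numExperts_pos T
  set K := numExperts T
  have hmS : Measurable (noiseSum P K ε ℰ.l T i) := measurable_noiseSum hP T i
  have iS := h.integrable_input hmS.norm fun a ha => by
    rw [abs_norm]; exact norm_noiseSum_le hP hW hK ha i (le_refl T)
  have iN : ∀ n ∈ Finset.range T, Integrable (fun ω =>
      inner ℝ (inputNoise P K ε ℰ.l n i (ℰ.input ω))
        ((inputState P K ε ℰ.l n (ℰ.input ω)).center i)) μ := fun n hn =>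
    h.integrable_input
      ((measurable_inputNoise hP n i).inner ((measurable_inputState hP n).center i))
      (C := 2 * (gradBound P W i * (T : ℝ) ^ (1 / 4 : ℝ)) * W)
      fun a ha => (abs_real_inner_le_norm _ _).trans
        (mul_le_mul (norm_inputNoise_le hP hW hK ha i (Finset.mem_range.1 hn))
          (norm_run_center_le hP hW hK ha i n) (norm_nonneg _)
          (mul_nonneg two_pos.le (mul_nonneg (gradBound_nonneg hP hW i) (by positivity))))
  set κ := ((closedNbhd G i).card : ℝ) / Fintype.card V
  have hκ : 0 ≤ κ := by positivity
  have iA := h.integrable_algLoss (ε := ε) hP hW T i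
  have iM := h.integrable_minLoss (ε := ε) hP hW T i
  have iNS := (integrable_finsetSum _ iN).add (iS.const_mul W)
  have iR := (integrable_const (μ := μ) (pathConst P W i * (T : ℝ) ^ (3 / 4 : ℝ))).add
    (iNS.const_mul κ)
  -- The pathwise bound is the same for every comparator, so it passes to the infimum before
  -- expectations are taken.
  have hpath := integral_mono_ae (iA.sub iM) iR (by
    filter_upwards [h.ae_isGood] with ω hω
    simp only [Pi.sub_apply, Pi.add_apply]
    rw [sub_le_comm, minLoss_eq]
    refine le_ciInf fun y => ?_
    rw [sub_le_comm, algLoss_eq]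
    exact sum_runLoss_sub_le hP hW hK hω i hT hε y.2)
  -- Noise paired with the centre integrates to zero; only the norm of the summed noise remains.
  rw [integral_sub' iA iM, integral_add' (integrable_const _) (iNS.const_mul κ),
    integral_const, integral_const_mul, integral_add' (integrable_finsetSum _ iN) (iS.const_mul W),
    integral_finsetSum _ iN, integral_const_mul,
    Finset.sum_eq_zero fun n _ => h.integral_inner_inputNoise_center hP hW hK n i] at hpath
  simp only [probReal_univ, one_smul, zero_add] at hpath
  have hS := integral_norm_noiseSum_le (ε := ε) h hP hW hK i hT
  rw [staticRegret]
  refine hpath.trans ?_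
  rw [add_mul, mul_assoc κ, mul_assoc W]
  have hW0 := hW.1
  gcongr

end Environment

end

end EnergySharing

theorem mainTheorem6 {V : Type*} [Fintype V] [DecidableEq V] (G : SimpleGraph V)
    [DecidableRel G.Adj] (P : EnergySharing.Params G) (hP : P.Valid) :
    ∃ (ε : ℕ → ℝ) (C : ℝ) (p : ℕ), (∀ T, 0 < ε T) ∧
      ∀ (Ω : Type*) [MeasurableSpace Ω] (μ : Measure Ω) [IsProbabilityMeasure μ]
        (ℰ : EnergySharing.Environment G Ω), ℰ.Valid P μ →
        ∀ T : ℕ, 1 ≤ T → ∀ i : V,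
          Integrable (ℰ.algLoss P (ε T) T i) μ ∧
          Integrable (ℰ.minLoss P (ε T) T i) μ ∧
          ℰ.staticRegret P (ε T) T i μ ≤
            C * (T : ℝ) ^ (3 / 4 : ℝ) * (1 + Real.log (T : ℝ)) ^ p := by
  obtain ⟨W, hW⟩ := hP.exists_isRadius
  set c : V → ℝ := fun i => EnergySharing.pathConst P W i +
    ((EnergySharing.closedNbhd G i).card : ℝ) / Fintype.card V *
      (W * EnergySharing.noiseConst P W i)
  -- The shift by 1 keeps the rate positive at `T = 0`, where the power of 0 would be 0. Summing
  -- absolute values gives one constant for all nodes, and the exponent 0 records that no logarithm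
  -- is needed.
  refine ⟨fun T => ((T : ℝ) + 1) ^ (-(3 / 4) : ℝ), ∑ i, |c i|, 0, fun T => by positivity, ?_⟩
  intro Ω _ μ _ ℰ h T hT i
  refine ⟨h.integrable_algLoss hP hW T i, h.integrable_minLoss hP hW T i, ?_⟩
  rw [pow_zero, mul_one]
  refine (h.staticRegret_le hP hW hT rfl i).trans ?_
  refine mul_le_mul_of_nonneg_right ?_ (by positivity)
  exact (le_abs_self (c i)).trans
    (Finset.single_le_sum (f := fun i => |c i|) (fun _ _ => abs_nonneg _) (Finset.mem_univ i))
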